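/- Let $(\mathbb{X},\mathbb{T})$ be a tangent category (in the sense of Cockett and Cruttwell, negatives not required) with tangent bundle functor $T$, projection $p\colon T\Rightarrow \mathrm{id}$, zero $z$, sum $s\colon T_2\Rightarrow T$, vertical lift $l\colon T\Rightarrow T^2$ and canonical flip $c\colon T^2\Rightarrow T^2$. A tangent pullback is a pullback square preserved by all iterates $T^n$. A morphism admits all tangent pullbacks if its pullback along every morphism into its codomain exists and is a tangent pullback. A morphism $q$ is a tangent display map if $T^nq$ admits all tangent pullbacks for every $n\ge 0$; it is tangent monic if $T^nq$ is a monomorphism for every $n\ge 0$; $q\colon E\to M$ is étale if the naturality square of $q$ with $p$ exhibits $TE$ as a tangent pullback of $q$ along $p_M\colon TM\to M$. A tangent display system is a class of morphisms, each admitting all tangent pullbacks, which is closed under tangent pullbacks along arbitrary morphisms and under $T$. A tangent display system of monics is a tangent display system that consists of étale monomorphisms, is closed under composition, and contains all isomorphisms. Let $\mathsf{Open}(\mathbb{X},\mathbb{T})$ be the class of all tangent monic, étale, tangent display maps (the monics underlying open subobjects). **Theorem.** (1) $\mathsf{Open}(\mathbb{X},\mathbb{T})$ is a tangent display system of monics,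 and it contains every tangent display system of monics of $(\mathbb{X},\mathbb{T})$. (2) Let $\mathsf{Par}(\mathbb{X},\mathbb{T})$ be the category with the objects of $\mathbb{X}$ whose morphisms $A\to B$ are isomorphism classes $[m,f]$ of spans $A\xleftarrow{m}D\xrightarrow{f}B$ with $m\in\mathsf{Open}(\mathbb{X},\mathbb{T})$, composed by pullback, with the restriction operator $\overline{[m,f]}=[m,m]$. It is a split restriction category. The functor $J\colon\mathbb{X}\to\mathsf{Par}(\mathbb{X},\mathbb{T})$ that is the identity on objects and sends $f$ to $[\mathrm{id},f]$ is injective on objects and faithful, and its image consists exactly of the total maps. (3) $\mathsf{Par}(\mathbb{X},\mathbb{T})$ carries a restriction tangent structure (a restriction functor $T'$ and total structural natural transformations $p',z',s',l',c'$ that satisfy the equational axioms of a tangent structure, where the $n$-fold pullbacks of the projection along itself, and the pullback expressing the universality of the vertical lift, are restriction pullbacks preserved by all iterates of $T'$) such that $T'[m,f]=[Tm,Tf]$ for every span and $J$ strictly preserves the tangent structure, i.e. $JT=T'J$, $JT_2=T_2'J$, and $J$ sends the projections of $T_2$ and $p,z,s,l,c$ to the corresponding transformations of $\mathsf{Par}(\mathbb{X},\mathbb{T})$.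 Thus every tangent category is canonically embedded in a split restriction tangent category. -/

import Mathlib

open CategoryTheory CategoryTheory.Limits

universe v u v' u'

namespace TangentCat

section Endofunctors

variable {C : Type u} [Category.{v} C]

/-- The iterates `T^n` of an endofunctor, with `T^0` the identity functor. -/
def iter (T : C ⥤ C) : ℕ → (C ⥤ C)
  | 0 => 𝟭 C
  | n + 1 => iter T n ⋙ T

/-- A `T`-pullback: a pullback square which is preserved by every iterate of `T`
(the case `n = 0` says that the square itself is a pullback). -/
def IsTPullback (T : C ⥤ C) {P A B D : C} (fst : P ⟶ A) (snd : P ⟶ B) (f : A ⟶ D) (g : B ⟶ D) :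
    Prop :=
  ∀ n : ℕ, IsPullback ((iter T n).map fst) ((iter T n).map snd)
    ((iter T n).map f) ((iter T n).map g)

/-- `base : P ⟶ M` with projections `π i : P ⟶ E` is the pullback of `n` copies of `q : E ⟶ M`
(for `n = 0` this says that `base` is an isomorphism). -/
structure IsPullbackPower {E M P : C} {n : ℕ} (q : E ⟶ M) (base : P ⟶ M) (π : Fin n → (P ⟶ E)) :
    Prop where
  w : ∀ i, π i ≫ q = base
  isLimit : Nonempty (IsLimit (WidePullbackCone.mk (f := fun _ : Fin n => q) base π w))

/-- A display map: all its pullbacks along arbitrary morphisms exist. -/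
def IsDisplayMap {E M : C} (q : E ⟶ M) : Prop :=
  ∀ ⦃N : C⦄ (f : N ⟶ M), HasPullback f q

/-- `q` admits all `T`-pullbacks: it is a display map and each of its pullbacks is a
`T`-pullback. -/
def AdmitsTPullbacks (T : C ⥤ C) {E M : C} (q : E ⟶ M) : Prop :=
  IsDisplayMap q ∧
    ∀ ⦃N P : C⦄ (f : N ⟶ M) (fst : P ⟶ N) (snd : P ⟶ E),
      IsPullback fst snd f q → IsTPullback T fst snd f q

/-- A `T`-display map: every iterate `T^n q` (`n ≥ 0`) admits all `T`-pullbacks. -/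
def IsTDisplayMap (T : C ⥤ C) {E M : C} (q : E ⟶ M) : Prop :=
  ∀ n : ℕ, AdmitsTPullbacks T ((iter T n).map q)

/-- A `T`-monic: a monomorphism all of whose iterates `T^n m` are monomorphisms. -/
def IsTMonic (T : C ⥤ C) {A B : C} (m : A ⟶ B) : Prop :=
  ∀ n : ℕ, Mono ((iter T n).map m)

/-- A `T`-display system: a family of morphisms that is stable under `T`-pullbacks (each member
admits all `T`-pullbacks and the family is closed under `T`-pullbacks) and stable under `T`. -/
structure IsTDisplaySystem (T : C ⥤ C) (D : MorphismProperty C) : Prop where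
  admits : ∀ ⦃E M : C⦄ (q : E ⟶ M), D q → AdmitsTPullbacks T q
  closed : ∀ ⦃P N E M : C⦄ (fst : P ⟶ N) (snd : P ⟶ E) (f : N ⟶ M) (q : E ⟶ M),
    IsTPullback T fst snd f q → D q → D fst
  map : ∀ ⦃E M : C⦄ (q : E ⟶ M), D q → D (T.map q)

/-- A display system of monics (also called a stable system of monics). -/
structure IsDisplaySystemOfMonics (M : MorphismProperty C) : Prop where
  mono : ∀ ⦃A B : C⦄ (m : A ⟶ B), M m → Mono m
  display : ∀ ⦃A B : C⦄ (m : A ⟶ B), M m → IsDisplayMap m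
  closed : ∀ ⦃P N E B : C⦄ (fst : P ⟶ N) (snd : P ⟶ E) (f : N ⟶ B) (m : E ⟶ B),
    IsPullback fst snd f m → M m → M fst
  comp : ∀ ⦃A B D : C⦄ (m : A ⟶ B) (m' : B ⟶ D), M m → M m' → M (m ≫ m')
  iso : ∀ ⦃A B : C⦄ (e : A ⟶ B), IsIso e → M e

end Endofunctors

/-! ### Tangent categories -/

/-- The data of a tangent structure: the tangent bundle functor `T`, the projection `p`, the
functor `T2` (meant to be the pullback of `p` along itself, with projections `π₁`, `π₂`), the zero
`z`, the sum `s`, the vertical lift `l` and the canonical flip `c`. -/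
structure TangentData (C : Type u) [Category.{v} C] where
  T : C ⥤ C
  p : T ⟶ 𝟭 C
  T2 : C ⥤ C
  π₁ : T2 ⟶ T
  π₂ : T2 ⟶ T
  z : 𝟭 C ⟶ T
  s : T2 ⟶ T
  l : T ⟶ T ⋙ T
  c : T ⋙ T ⟶ T ⋙ T

namespace TangentData

variable {C : Type u} [Category.{v} C]

/-- The equational axioms of a tangent structure. A morphism into `T2 A` (or into `T (T2 A)`) is
specified by its composites with the two projections: `u ≫ π₁ = a` and `u ≫ π₂ = b` together say
that `u = ⟨a, b⟩`. -/
structure Equations (𝕋 : TangentData C) : Prop where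
  /-- `(p, z, s)` is an additive bundle, i.e. a commutative monoid in the slice over `A`. -/
  z_p : ∀ A, 𝕋.z.app A ≫ 𝕋.p.app A = 𝟙 A
  s_p : ∀ A, 𝕋.s.app A ≫ 𝕋.p.app A = 𝕋.π₁.app A ≫ 𝕋.p.app A
  s_unit : ∀ ⦃A X : C⦄ (u : X ⟶ 𝕋.T2.obj A),
    u ≫ 𝕋.π₂.app A = u ≫ 𝕋.π₁.app A ≫ 𝕋.p.app A ≫ 𝕋.z.app A →
      u ≫ 𝕋.s.app A = u ≫ 𝕋.π₁.app A
  s_comm : ∀ ⦃A X : C⦄ (u v : X ⟶ 𝕋.T2.obj A),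
    v ≫ 𝕋.π₁.app A = u ≫ 𝕋.π₂.app A → v ≫ 𝕋.π₂.app A = u ≫ 𝕋.π₁.app A →
      v ≫ 𝕋.s.app A = u ≫ 𝕋.s.app A
  /-- With `u = ⟨a, b⟩`, `v = ⟨b, d⟩`, `u' = ⟨a + b, d⟩`, `v' = ⟨a, b + d⟩`. -/
  s_assoc : ∀ ⦃A X : C⦄ (u v u' v' : X ⟶ 𝕋.T2.obj A),
    v ≫ 𝕋.π₁.app A = u ≫ 𝕋.π₂.app A →
    u' ≫ 𝕋.π₁.app A = u ≫ 𝕋.s.app A → u' ≫ 𝕋.π₂.app A = v ≫ 𝕋.π₂.app A →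
    v' ≫ 𝕋.π₁.app A = u ≫ 𝕋.π₁.app A → v' ≫ 𝕋.π₂.app A = v ≫ 𝕋.s.app A →
      u' ≫ 𝕋.s.app A = v' ≫ 𝕋.s.app A
  /-- `(l, z)` is an additive bundle morphism from `p` to `T p`. -/
  l_p : ∀ A, 𝕋.l.app A ≫ 𝕋.T.map (𝕋.p.app A) = 𝕋.p.app A ≫ 𝕋.z.app A
  z_l : ∀ A, 𝕋.z.app A ≫ 𝕋.l.app A = 𝕋.z.app A ≫ 𝕋.T.map (𝕋.z.app A)
  s_l : ∀ ⦃A X : C⦄ (u : X ⟶ 𝕋.T2.obj A) (w : X ⟶ 𝕋.T.obj (𝕋.T2.obj A)),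
    w ≫ 𝕋.T.map (𝕋.π₁.app A) = u ≫ 𝕋.π₁.app A ≫ 𝕋.l.app A →
    w ≫ 𝕋.T.map (𝕋.π₂.app A) = u ≫ 𝕋.π₂.app A ≫ 𝕋.l.app A →
      w ≫ 𝕋.T.map (𝕋.s.app A) = u ≫ 𝕋.s.app A ≫ 𝕋.l.app A
  /-- `(c, id)` is an additive bundle morphism from `T p` to `p_T`. -/
  c_p : ∀ A, 𝕋.c.app A ≫ 𝕋.p.app (𝕋.T.obj A) = 𝕋.T.map (𝕋.p.app A)
  z_c : ∀ A, 𝕋.T.map (𝕋.z.app A) ≫ 𝕋.c.app A = 𝕋.z.app (𝕋.T.obj A)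
  s_c : ∀ ⦃A X : C⦄ (w : X ⟶ 𝕋.T.obj (𝕋.T2.obj A)) (u : X ⟶ 𝕋.T2.obj (𝕋.T.obj A)),
    u ≫ 𝕋.π₁.app (𝕋.T.obj A) = w ≫ 𝕋.T.map (𝕋.π₁.app A) ≫ 𝕋.c.app A →
    u ≫ 𝕋.π₂.app (𝕋.T.obj A) = w ≫ 𝕋.T.map (𝕋.π₂.app A) ≫ 𝕋.c.app A →
      u ≫ 𝕋.s.app (𝕋.T.obj A) = w ≫ 𝕋.T.map (𝕋.s.app A) ≫ 𝕋.c.app A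
  /-- Coherence of the vertical lift and the canonical flip. -/
  c_c : ∀ A, 𝕋.c.app A ≫ 𝕋.c.app A = 𝟙 (𝕋.T.obj (𝕋.T.obj A))
  l_c : ∀ A, 𝕋.l.app A ≫ 𝕋.c.app A = 𝕋.l.app A
  l_l : ∀ A, 𝕋.l.app A ≫ 𝕋.T.map (𝕋.l.app A) = 𝕋.l.app A ≫ 𝕋.l.app (𝕋.T.obj A)
  c_c_c : ∀ A,
    𝕋.T.map (𝕋.c.app A) ≫ 𝕋.c.app (𝕋.T.obj A) ≫ 𝕋.T.map (𝕋.c.app A) =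
      𝕋.c.app (𝕋.T.obj A) ≫ 𝕋.T.map (𝕋.c.app A) ≫ 𝕋.c.app (𝕋.T.obj A)
  l_c_c : ∀ A,
    𝕋.l.app (𝕋.T.obj A) ≫ 𝕋.T.map (𝕋.c.app A) ≫ 𝕋.c.app (𝕋.T.obj A) =
      𝕋.c.app A ≫ 𝕋.T.map (𝕋.l.app A)

/-- `(C, 𝕋)` is a tangent category. -/
structure IsTangent (𝕋 : TangentData C) : Prop extends Equations 𝕋 where
  /-- For each `n`, the pullback of `n` copies of `p` exists and is preserved by each `T^m`. -/
  powers : ∀ (n : ℕ) (A : C), ∃ (P : C) (base : P ⟶ A) (π : Fin n → (P ⟶ 𝕋.T.obj A)),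
    ∀ m : ℕ, IsPullbackPower ((iter 𝕋.T m).map (𝕋.p.app A)) ((iter 𝕋.T m).map base)
      (fun i => (iter 𝕋.T m).map (π i))
  T2_pullback : ∀ A,
    IsTPullback 𝕋.T (𝕋.π₁.app A) (𝕋.π₂.app A) (𝕋.p.app A) (𝕋.p.app A)
  /-- Universality of the vertical lift; here `w = ⟨π₁ l, π₂ z_T⟩`. -/
  universal : ∀ A, ∃ w : 𝕋.T2.obj A ⟶ 𝕋.T.obj (𝕋.T2.obj A),
    w ≫ 𝕋.T.map (𝕋.π₁.app A) = 𝕋.π₁.app A ≫ 𝕋.l.app A ∧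
    w ≫ 𝕋.T.map (𝕋.π₂.app A) = 𝕋.π₂.app A ≫ 𝕋.z.app (𝕋.T.obj A) ∧
    IsTPullback 𝕋.T (w ≫ 𝕋.T.map (𝕋.s.app A)) (𝕋.π₁.app A ≫ 𝕋.p.app A)
      (𝕋.T.map (𝕋.p.app A)) (𝕋.z.app A)

/-- An étale map: the naturality square of `q` with the projection is a tangent pullback. -/
def IsEtale (𝕋 : TangentData C) {E M : C} (q : E ⟶ M) : Prop :=
  IsTPullback 𝕋.T (𝕋.p.app E) (𝕋.T.map q) q (𝕋.p.app M)

/-- The class of monics underlying open subobjects: the tangent monic display étale maps. -/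
def opens (𝕋 : TangentData C) : MorphismProperty C := fun _ _ m =>
  IsTMonic 𝕋.T m ∧ IsTDisplayMap 𝕋.T m ∧ 𝕋.IsEtale m

/-- A tangent display system of monics of `(C, 𝕋)`. -/
structure IsDisplaySystemOfMonics (𝕋 : TangentData C) (M : MorphismProperty C) : Prop where
  mono : ∀ ⦃A B : C⦄ (m : A ⟶ B), M m → Mono m
  etale : ∀ ⦃A B : C⦄ (m : A ⟶ B), M m → 𝕋.IsEtale m
  system : IsTDisplaySystem 𝕋.T M
  comp : ∀ ⦃A B D : C⦄ (m : A ⟶ B) (m' : B ⟶ D), M m → M m' → M (m ≫ m')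
  iso : ∀ ⦃A B : C⦄ (e : A ⟶ B), IsIso e → M e

/-- A tangent display system of monics is a display system of monics. -/
theorem IsDisplaySystemOfMonics.toPlain {𝕋 : TangentData C} {M : MorphismProperty C}
    (h : 𝕋.IsDisplaySystemOfMonics M) : TangentCat.IsDisplaySystemOfMonics M where
  mono := h.mono
  display := fun _ _ m hm => (h.system.admits m hm).1
  closed := fun _ _ _ _ fst snd f m hp hm =>
    h.system.closed fst snd f m ((h.system.admits m hm).2 f fst snd hp) hm
  comp := h.comp
  iso := h.iso

end TangentData

/-! ### Restriction categories -/

/-- A restriction operator, assigning to each `f : A ⟶ B` an endomorphism `rst f` of `A`. -/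
class HasRestriction (X : Type u) [Category.{v} X] where
  rst : ∀ {A B : X}, (A ⟶ B) → (A ⟶ A)

open HasRestriction

section Restriction

variable (X : Type u) [Category.{v} X] [HasRestriction X]

/-- The four axioms of a restriction category. -/
structure IsRestrictionCategory : Prop where
  rst_comp_self : ∀ {A B : X} (f : A ⟶ B), rst f ≫ f = f
  rst_comm : ∀ {A B D : X} (f : A ⟶ B) (g : A ⟶ D), rst f ≫ rst g = rst g ≫ rst f
  rst_rst_comp : ∀ {A B D : X} (f : A ⟶ B) (g : A ⟶ D), rst (rst f ≫ g) = rst f ≫ rst g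
  comp_rst : ∀ {A B D : X} (f : A ⟶ B) (g : B ⟶ D), f ≫ rst g = rst (f ≫ g) ≫ f

/-- Every restriction idempotent splits. -/
def RestrictionIdempotentsSplit : Prop :=
  ∀ ⦃A B : X⦄ (f : A ⟶ B), ∃ (S : X) (i : S ⟶ A) (r : A ⟶ S), i ≫ r = 𝟙 S ∧ r ≫ i = rst f

/-- A split restriction category. -/
structure IsSplitRestrictionCategory : Prop extends IsRestrictionCategory X where
  split : RestrictionIdempotentsSplit X

variable {X}

/-- Total maps. -/
def IsTotal {A B : X} (f : A ⟶ B) : Prop := rst f = 𝟙 A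

/-- The restriction order: `f ≤ g` when `f` is the restriction of `g` to the domain of `f`. -/
def RLe {A B : X} (f g : A ⟶ B) : Prop := rst f ≫ g = f

/-- Restriction pullbacks, i.e. restriction limits of cospans: cones of total maps which are
universal among lax cones, the domain of the induced map being the intersection of the domains of
the components of the lax cone. -/
structure IsRestrictionPullback {P A B D : X} (fst : P ⟶ A) (snd : P ⟶ B) (f : A ⟶ D)
    (g : B ⟶ D) : Prop where
  w : fst ≫ f = snd ≫ g
  total_fst : IsTotal fst
  total_snd : IsTotal snd
  total_comp : IsTotal (fst ≫ f)
  lift : ∀ ⦃Y : X⦄ (a : Y ⟶ A) (b : Y ⟶ B) (d : Y ⟶ D), RLe (a ≫ f) d → RLe (b ≫ g) d →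
    ∃! h : Y ⟶ P, RLe (h ≫ fst) a ∧ RLe (h ≫ snd) b ∧ RLe (h ≫ fst ≫ f) d ∧
      rst h = rst a ≫ rst b ≫ rst d

/-- The restriction pullback of `n` copies of `q : E ⟶ M`, i.e. the restriction limit of the
corresponding wide cospan. -/
structure IsRestrictionPullbackPower {E M P : X} {n : ℕ} (q : E ⟶ M) (base : P ⟶ M)
    (π : Fin n → (P ⟶ E)) : Prop where
  w : ∀ i, π i ≫ q = base
  total_base : IsTotal base
  total_π : ∀ i, IsTotal (π i)
  lift : ∀ ⦃Y : X⦄ (d : Y ⟶ M) (a : Fin n → (Y ⟶ E)), (∀ i, RLe (a i ≫ q) d) →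
    ∃! h : Y ⟶ P, RLe (h ≫ base) d ∧ (∀ i, RLe (h ≫ π i) (a i)) ∧
      rst h = (List.ofFn a).foldr (fun b e => rst b ≫ e) (rst d)

/-- A restriction pullback preserved by all iterates of `T`. -/
def IsRestrictionTPullback (T : X ⥤ X) {P A B D : X} (fst : P ⟶ A) (snd : P ⟶ B) (f : A ⟶ D)
    (g : B ⟶ D) : Prop :=
  ∀ n : ℕ, IsRestrictionPullback ((iter T n).map fst) ((iter T n).map snd)
    ((iter T n).map f) ((iter T n).map g)

/-- `(X, 𝕋)` is a restriction tangent category: `T` is a restriction functor, the structural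
natural transformations are total, the equations of a tangent structure hold, and the limits
required of a tangent structure are replaced by restriction limits. -/
structure TangentData.IsRestrictionTangent (𝕋 : TangentData X) : Prop
    extends IsRestrictionCategory X, TangentData.Equations 𝕋 where
  map_rst : ∀ ⦃A B : X⦄ (f : A ⟶ B), 𝕋.T.map (rst f) = rst (𝕋.T.map f)
  total_p : ∀ A, IsTotal (𝕋.p.app A)
  total_z : ∀ A, IsTotal (𝕋.z.app A)
  total_s : ∀ A, IsTotal (𝕋.s.app A)
  total_l : ∀ A, IsTotal (𝕋.l.app A)
  total_c : ∀ A, IsTotal (𝕋.c.app A)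
  powers : ∀ (n : ℕ) (A : X), ∃ (P : X) (base : P ⟶ A) (π : Fin n → (P ⟶ 𝕋.T.obj A)),
    ∀ m : ℕ, IsRestrictionPullbackPower ((iter 𝕋.T m).map (𝕋.p.app A))
      ((iter 𝕋.T m).map base) (fun i => (iter 𝕋.T m).map (π i))
  T2_pullback : ∀ A,
    IsRestrictionTPullback 𝕋.T (𝕋.π₁.app A) (𝕋.π₂.app A) (𝕋.p.app A) (𝕋.p.app A)
  universal : ∀ A, ∃ w : 𝕋.T2.obj A ⟶ 𝕋.T.obj (𝕋.T2.obj A),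
    w ≫ 𝕋.T.map (𝕋.π₁.app A) = 𝕋.π₁.app A ≫ 𝕋.l.app A ∧
    w ≫ 𝕋.T.map (𝕋.π₂.app A) = 𝕋.π₂.app A ≫ 𝕋.z.app (𝕋.T.obj A) ∧
    IsRestrictionTPullback 𝕋.T (w ≫ 𝕋.T.map (𝕋.s.app A)) (𝕋.π₁.app A ≫ 𝕋.p.app A)
      (𝕋.T.map (𝕋.p.app A)) (𝕋.z.app A)

end Restriction

/-! ### Strict preservation of tangent structure -/

/-- `F` commutes on the nose with the tangent bundle functors, with the functors `T2`, and with all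
structural natural transformations. The `eqToHom`s are the identities given by the equalities of
objects `F (T A) = T' (F A)` etc. -/
structure IsStrictTangentFunctor {C : Type u} [Category.{v} C] {D : Type u'} [Category.{v'} D]
    (F : C ⥤ D) (𝕊 : TangentData C) (𝕋 : TangentData D) : Prop where
  T_comm : 𝕊.T ⋙ F = F ⋙ 𝕋.T
  T2_comm : 𝕊.T2 ⋙ F = F ⋙ 𝕋.T2
  obj_T : ∀ A, F.obj (𝕊.T.obj A) = 𝕋.T.obj (F.obj A) := fun A => Functor.congr_obj T_comm A
  obj_T2 : ∀ A, F.obj (𝕊.T2.obj A) = 𝕋.T2.obj (F.obj A) := fun A => Functor.congr_obj T2_comm A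
  obj_TT : ∀ A, F.obj (𝕊.T.obj (𝕊.T.obj A)) = 𝕋.T.obj (𝕋.T.obj (F.obj A)) :=
    fun A => (obj_T (𝕊.T.obj A)).trans (congrArg 𝕋.T.obj (obj_T A))
  map_p : ∀ A, F.map (𝕊.p.app A) = eqToHom (obj_T A) ≫ 𝕋.p.app (F.obj A)
  map_z : ∀ A, F.map (𝕊.z.app A) ≫ eqToHom (obj_T A) = 𝕋.z.app (F.obj A)
  map_π₁ : ∀ A, F.map (𝕊.π₁.app A) ≫ eqToHom (obj_T A) =
    eqToHom (obj_T2 A) ≫ 𝕋.π₁.app (F.obj A)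
  map_π₂ : ∀ A, F.map (𝕊.π₂.app A) ≫ eqToHom (obj_T A) =
    eqToHom (obj_T2 A) ≫ 𝕋.π₂.app (F.obj A)
  map_s : ∀ A, F.map (𝕊.s.app A) ≫ eqToHom (obj_T A) =
    eqToHom (obj_T2 A) ≫ 𝕋.s.app (F.obj A)
  map_l : ∀ A, F.map (𝕊.l.app A) ≫ eqToHom (obj_TT A) =
    eqToHom (obj_T A) ≫ 𝕋.l.app (F.obj A)
  map_c : ∀ A, F.map (𝕊.c.app A) ≫ eqToHom (obj_TT A) =
    eqToHom (obj_TT A) ≫ 𝕋.c.app (F.obj A)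

/-! ### The category of partial maps -/

section Par

variable {C : Type u} [Category.{v} C]

/-- A span from `A` to `B` whose left leg belongs to `M`. -/
structure MSpan (M : MorphismProperty C) (A B : C) where
  dom : C
  incl : dom ⟶ A
  map : dom ⟶ B
  mem : M incl

/-- Spans are identified up to isomorphism. -/
def MSpan.setoid (M : MorphismProperty C) (A B : C) : Setoid (MSpan M A B) where
  r f g := ∃ e : f.dom ≅ g.dom, e.hom ≫ g.incl = f.incl ∧ e.hom ≫ g.map = f.map
  iseqv :=
    { refl := fun f => ⟨Iso.refl _, by simp, by simp⟩
      symm := by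
        rintro f g ⟨e, h₁, h₂⟩
        exact ⟨e.symm, by simp [← h₁], by simp [← h₂]⟩
      trans := by
        rintro f g h ⟨e, h₁, h₂⟩ ⟨e', h₁', h₂'⟩
        exact ⟨e ≪≫ e', by simp [h₁, h₁'], by simp [h₂, h₂']⟩ }

/-- The objects of the category of partial maps: those of `C`. -/
structure Par {M : MorphismProperty C} (hM : IsDisplaySystemOfMonics M) : Type u where
  of : C

variable {M : MorphismProperty C} (hM : IsDisplaySystemOfMonics M)

/-- Composition of spans by a choice of pullback. -/
noncomputable def MSpan.comp {A B D : C} (f : MSpan M A B) (g : MSpan M B D) : MSpan M A D :=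
  have := hM.display g.incl g.mem f.map
  { dom := pullback f.map g.incl
    incl := pullback.fst f.map g.incl ≫ f.incl
    map := pullback.snd f.map g.incl ≫ g.map
    mem := hM.comp _ _
      (hM.closed _ _ _ _ (IsPullback.of_hasPullback f.map g.incl) g.mem) f.mem }

/-- The span `A = A ⟶ B` of a morphism of `C`. -/
def MSpan.total {A B : C} (f : A ⟶ B) : MSpan M A B :=
  ⟨A, 𝟙 A, f, hM.iso _ inferInstance⟩

/-- Morphisms of the category of partial maps: isomorphism classes of spans. -/
def MSpan.Hom (M : MorphismProperty C) (A B : C) : Type (max u v) :=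
  Quotient (MSpan.setoid M A B)

/-- The isomorphism class of a span. -/
def MSpan.toHom {A B : C} (f : MSpan M A B) : MSpan.Hom M A B := Quotient.mk _ f

theorem MSpan.toHom_eq {A B : C} {f g : MSpan M A B} (e : f.dom ≅ g.dom)
    (h₁ : e.hom ≫ g.incl = f.incl) (h₂ : e.hom ≫ g.map = f.map) : f.toHom = g.toHom :=
  Quotient.sound ⟨e, h₁, h₂⟩

/-- The composite of spans may be computed with any pullback. -/
theorem MSpan.comp_toHom_eq {A B D P : C} (f : MSpan M A B) (g : MSpan M B D) (a : P ⟶ f.dom)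
    (b : P ⟶ g.dom) (h : IsPullback a b f.map g.incl) (k : MSpan M A D) (i : k.dom ≅ P)
    (h₁ : k.incl = i.hom ≫ a ≫ f.incl) (h₂ : k.map = i.hom ≫ b ≫ g.map) :
    (f.comp hM g).toHom = k.toHom := by
  have := hM.display g.incl g.mem f.map
  refine (MSpan.toHom_eq (i ≪≫ h.isoPullback) ?_ ?_).symm
  · simp [MSpan.comp, h₁]
  · simp [MSpan.comp, h₂]

/-- Composition of isomorphism classes of spans. -/
noncomputable def MSpan.Hom.comp {A B D : C} :
    MSpan.Hom M A B → MSpan.Hom M B D → MSpan.Hom M A D :=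
  Quotient.lift₂ (fun f g => (f.comp hM g).toHom) (by
    rintro f g f' g' ⟨e, h₁, h₂⟩ ⟨e', h₁', h₂'⟩
    have := hM.display g'.incl g'.mem f'.map
    have sq : IsPullback (pullback.fst f'.map g'.incl ≫ e.inv) (pullback.snd f'.map g'.incl ≫ e'.inv)
        f.map g.incl := by
      refine IsPullback.of_iso (IsPullback.of_hasPullback f'.map g'.incl)
        (Iso.refl _) e.symm e'.symm (Iso.refl _) ?_ ?_ ?_ ?_
      · simp
      · simp
      · simp [← h₂]
      · simp [← h₁']
    refine MSpan.comp_toHom_eq hM f g _ _ sq _ (Iso.refl _) ?_ ?_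
    · simp [MSpan.comp, ← h₁]
    · simp [MSpan.comp, ← h₂'])

theorem MSpan.toHom_comp_toHom {A B D : C} (f : MSpan M A B) (g : MSpan M B D) :
    MSpan.Hom.comp hM f.toHom g.toHom = (f.comp hM g).toHom := rfl

/-- The category of partial maps. -/
noncomputable instance Par.category : Category.{max u v} (Par hM) where
  Hom A B := MSpan.Hom M A.of B.of
  id A := (MSpan.total hM (𝟙 A.of)).toHom
  comp f g := MSpan.Hom.comp hM f g
  id_comp := by
    rintro A B ⟨f⟩
    have : IsIso (MSpan.total hM (𝟙 A.of)).map := inferInstanceAs (IsIso (𝟙 A.of))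
    exact MSpan.comp_toHom_eq hM _ f f.incl (𝟙 f.dom)
      (IsPullback.of_vert_isIso ⟨by simp [MSpan.total]⟩)
      f (Iso.refl _) (by simp [MSpan.total]) (by simp)
  comp_id := by
    rintro A B ⟨f⟩
    have : IsIso (MSpan.total hM (𝟙 B.of)).incl := inferInstanceAs (IsIso (𝟙 B.of))
    exact MSpan.comp_toHom_eq hM f _ (𝟙 f.dom) f.map
      (IsPullback.of_horiz_isIso ⟨by simp [MSpan.total]⟩)
      f (Iso.refl _) (by simp) (by simp [MSpan.total])
  assoc := by
    rintro A B D E ⟨f⟩ ⟨g⟩ ⟨h⟩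
    have := hM.display g.incl g.mem f.map
    have := hM.display h.incl h.mem g.map
    have hP := IsPullback.of_hasPullback f.map g.incl
    have hQ := IsPullback.of_hasPullback g.map h.incl
    have hq : M (pullback.fst g.map h.incl) := hM.closed _ _ _ _ hQ h.mem
    have := hM.display _ hq (pullback.snd f.map g.incl)
    have hR := IsPullback.of_hasPullback (pullback.snd f.map g.incl) (pullback.fst g.map h.incl)
    let k : MSpan M A.of E.of :=
      { dom := pullback (pullback.snd f.map g.incl) (pullback.fst g.map h.incl)
        incl := pullback.fst _ _ ≫ pullback.fst f.map g.incl ≫ f.incl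
        map := pullback.snd _ _ ≫ pullback.snd g.map h.incl ≫ h.map
        mem := hM.comp _ _ (hM.closed _ _ _ _ hR hq)
          (hM.comp _ _ (hM.closed _ _ _ _ hP g.mem) f.mem) }
    refine Eq.trans (b := k.toHom) ?_ (Eq.symm ?_)
    · exact MSpan.comp_toHom_eq hM (f.comp hM g) h _ _ (hR.flip.paste_horiz hQ.flip).flip
        k (Iso.refl _) (by simp [k, MSpan.comp]) (by simp [k])
    · exact MSpan.comp_toHom_eq hM f (g.comp hM h) _ _ (hR.paste_horiz hP)
        k (Iso.refl _) (by simp [k]) (by simp [k, MSpan.comp])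

/-- The restriction of the partial map `[m, f]` is `[m, m]`. -/
instance Par.restriction : HasRestriction (Par hM) where
  rst {A _} f := Quotient.lift
    (fun f => (⟨f.dom, f.incl, f.incl, f.mem⟩ : MSpan M A.of A.of).toHom)
    (by
      rintro f g ⟨e, h₁, h₂⟩
      exact MSpan.toHom_eq e h₁ h₁) f

/-- The partial map given by a span. -/
def Par.homMk {A B : C} (f : MSpan M A B) : (Par.mk A : Par hM) ⟶ Par.mk B := f.toHom

/-- The canonical functor from `C` to the category of partial maps: the identity on objects, and
sending `f` to the everywhere defined partial map `[𝟙, f]`. -/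
def Par.incl : C ⥤ Par hM where
  obj A := ⟨A⟩
  map f := Par.homMk hM (MSpan.total hM f)
  map_id _ := rfl
  map_comp {A B _} f g := by
    refine (MSpan.comp_toHom_eq hM (MSpan.total hM f) (MSpan.total hM g) (𝟙 A) f ?_ _
      (Iso.refl _) ?_ ?_).symm
    · change IsPullback (𝟙 A) f f (𝟙 B)
      exact IsPullback.of_horiz_isIso ⟨by simp⟩
    · simp [MSpan.total]
    · simp [MSpan.total]

/-- The span `T A ⟵ T D ⟶ T B` obtained by applying `T` to a span `A ⟵ D ⟶ B`. -/
def MSpan.mapT {T : C ⥤ C} (hT : IsTDisplaySystem T M) {A B : C} (f : MSpan M A B) :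
    MSpan M (T.obj A) (T.obj B) :=
  ⟨T.obj f.dom, T.map f.incl, T.map f.map, hT.map _ f.mem⟩

end Par

end TangentCat

namespace TangentCat

/-! ### Tangent pullbacks and maps admitting them -/

section Endofunctors

variable {C : Type u} [Category.{v} C] {T : C ⥤ C}

/-! Being tangent monic, tangent display and étale are each stable under tangent pullback and
composition, by pasting and cancelling pullback squares. Stability under `T` is a shift of the
iterates, except for étaleness: applying `T` to an étale square produces `T p` where `p_T` is
wanted, and the flip `c`, being invertible, exchanges the two (`IsEtale.map`). Maximality holds
because a display system is closed under `T`: every `T^n m` is again a member, hence monic and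
admitting tangent pullbacks.

For partial maps, the left leg of a span is monic, so two spans with the same left leg are
isomorphic only if their right legs agree (`Par.ofSpan_injective`), and composing with a total map
does not change the left leg (`Par.rst_comp_incl`). Equations between partial maps therefore reduce
to equations in `C` once all maps are put on a common domain, and an ordinary pullback becomes a
restriction pullback because a lax cone, restricted to the intersection of its domains, is an
ordinary cone.

The tangent structure extends because étaleness says that `p` is cartesian at open monics.
Cancellation (`CartesianOn.of_comp`) then makes `z`, `s`, `l`, `c` and the projections of `T2`
cartesian, since each becomes a known cartesian transformation after composing with projections.
Cartesianness is what naturality against partial maps requires, and a cartesian transformation to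
the identity forces its source functor to preserve open monics and their pullbacks
(`CartesianOn.preservesSpans`), so `T` and `T2` act on spans. -/

theorem iter_add (T : C ⥤ C) (m n : ℕ) : iter T (m + n) = iter T m ⋙ iter T n := by
  induction n with
  | zero => rfl
  | succ n ih =>
    change iter T (m + n) ⋙ T = _
    rw [ih]
    rfl

/-- `iter` adds the new copy of `T` last; closure of the open monics under `T` needs it first. -/
theorem iter_succ_left (T : C ⥤ C) (n : ℕ) : iter T (n + 1) = T ⋙ iter T n := by
  rw [add_comm, iter_add]
  rfl

namespace IsTPullback

theorem isPullback {P A B D : C} {fst : P ⟶ A} {snd : P ⟶ B} {f : A ⟶ D} {g : B ⟶ D}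
    (h : IsTPullback T fst snd f g) : IsPullback fst snd f g := h 0

theorem iterate {P A B D : C} {fst : P ⟶ A} {snd : P ⟶ B} {f : A ⟶ D} {g : B ⟶ D}
    (h : IsTPullback T fst snd f g) (n : ℕ) :
    IsTPullback T ((iter T n).map fst) ((iter T n).map snd) ((iter T n).map f)
      ((iter T n).map g) := fun k => by
  have := h (n + k)
  rw [iter_add] at this
  exact this

theorem flip {P A B D : C} {fst : P ⟶ A} {snd : P ⟶ B} {f : A ⟶ D} {g : B ⟶ D}
    (h : IsTPullback T fst snd f g) : IsTPullback T snd fst g f := fun n => (h n).flip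

theorem paste_vert {X₁₁ X₁₂ X₂₁ X₂₂ X₃₁ X₃₂ : C} {h₁₁ : X₁₁ ⟶ X₁₂} {h₂₁ : X₂₁ ⟶ X₂₂}
    {h₃₁ : X₃₁ ⟶ X₃₂} {v₁₁ : X₁₁ ⟶ X₂₁} {v₁₂ : X₁₂ ⟶ X₂₂} {v₂₁ : X₂₁ ⟶ X₃₁} {v₂₂ : X₂₂ ⟶ X₃₂}
    (s : IsTPullback T h₁₁ v₁₁ v₁₂ h₂₁) (t : IsTPullback T h₂₁ v₂₁ v₂₂ h₃₁) :
    IsTPullback T h₁₁ (v₁₁ ≫ v₂₁) (v₁₂ ≫ v₂₂) h₃₁ := fun n => by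
  simpa using (s n).paste_vert (t n)

theorem of_bot {X₁₁ X₁₂ X₂₁ X₂₂ X₃₁ X₃₂ : C} {h₁₁ : X₁₁ ⟶ X₁₂} {h₂₁ : X₂₁ ⟶ X₂₂}
    {h₃₁ : X₃₁ ⟶ X₃₂} {v₁₁ : X₁₁ ⟶ X₂₁} {v₁₂ : X₁₂ ⟶ X₂₂} {v₂₁ : X₂₁ ⟶ X₃₁} {v₂₂ : X₂₂ ⟶ X₃₂}
    (s : IsTPullback T h₁₁ (v₁₁ ≫ v₂₁) (v₁₂ ≫ v₂₂) h₃₁) (w : h₁₁ ≫ v₁₂ = v₁₁ ≫ h₂₁)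
    (t : IsTPullback T h₂₁ v₂₁ v₂₂ h₃₁) : IsTPullback T h₁₁ v₁₁ v₁₂ h₂₁ := fun n => by
  refine IsPullback.of_bot (v₂₁ := (iter T n).map v₂₁) (v₂₂ := (iter T n).map v₂₂) ?_ ?_ (t n)
  · simpa using s n
  · simp only [← Functor.map_comp, w]

theorem of_horiz_isIso {P A B D : C} {fst : P ⟶ A} {snd : P ⟶ B} {f : A ⟶ D} {g : B ⟶ D}
    [IsIso fst] [IsIso g] (w : fst ≫ f = snd ≫ g) : IsTPullback T fst snd f g := fun n =>
  IsPullback.of_horiz_isIso ⟨by simp only [← Functor.map_comp, w]⟩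

end IsTPullback

namespace AdmitsTPullbacks

theorem of_isTPullback {P N E M : C} {fst : P ⟶ N} {snd : P ⟶ E} {f : N ⟶ M} {q : E ⟶ M}
    (hq : AdmitsTPullbacks T q) (h : IsTPullback T fst snd f q) : AdmitsTPullbacks T fst := by
  refine ⟨fun X g => ?_, fun X Q g a b hab => ?_⟩
  · have := hq.1 (g ≫ f)
    have hp := IsPullback.of_hasPullback (g ≫ f) q
    -- The pullback of `q` along `g ≫ f` factors through the given square, and cancelling that
    -- square leaves a pullback of `fst` along `g`.
    exact (IsPullback.of_bot (h₁₁ := pullback.fst (g ≫ f) q)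
      (v₁₁ := h.isPullback.lift (pullback.fst _ _ ≫ g) (pullback.snd _ _) (by simpa using hp.w))
      (by simpa using hp) (by simp) h.isPullback).hasPullback
  · exact (hq.2 _ _ _ (hab.paste_vert h.isPullback)).of_bot hab.w h

theorem comp {A B D : C} {m : A ⟶ B} {m' : B ⟶ D} (hm : AdmitsTPullbacks T m)
    (hm' : AdmitsTPullbacks T m') : AdmitsTPullbacks T (m ≫ m') := by
  have display : IsDisplayMap (m ≫ m') := fun X g => by
    have := hm'.1 g
    have := hm.1 (pullback.snd g m')
    exact ((IsPullback.of_hasPullback (pullback.snd g m') m).paste_horiz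
      (IsPullback.of_hasPullback g m')).hasPullback
  refine ⟨display, fun N P g a b hab => ?_⟩
  have := hm'.1 g
  have right := IsPullback.of_hasPullback g m'
  -- An arbitrary pullback of `m ≫ m'` is split through a chosen pullback of `m'`; each half is then
  -- preserved by the iterates of `T`.
  let k : P ⟶ pullback g m' := pullback.lift a (b ≫ m) (by simpa using hab.w)
  have left : IsPullback k b (pullback.snd g m') m :=
    IsPullback.of_right (by simpa only [k, pullback.lift_fst] using hab)
      (by simp only [k, pullback.lift_snd]) right
  have := fun n => (hm.2 _ _ _ left n).paste_horiz (hm'.2 _ _ _ right n)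
  intro n
  simpa only [k, ← Functor.map_comp, pullback.lift_fst] using this n

theorem of_isIso {A B : C} (e : A ⟶ B) [IsIso e] : AdmitsTPullbacks T e := by
  refine ⟨fun X g => ?_, fun N P g a b hab => ?_⟩
  · exact (IsPullback.of_horiz_isIso (fst := 𝟙 X) (snd := g ≫ inv e) ⟨by simp⟩).hasPullback
  · have : IsIso a := hab.isIso_fst_of_isIso
    exact IsTPullback.of_horiz_isIso hab.w

end AdmitsTPullbacks

end Endofunctors

/-! ### Étale maps and the maximality of the open monics -/

namespace TangentData

variable {C : Type u} [Category.{v} C] {𝕋 : TangentData C}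

/-- Paste the `T`-image of the square with the étale square of `q`. By naturality of `p` the outer
rectangle is also the naturality square of `fst` pasted with the original square, which cancels. -/
theorem IsEtale.of_isTPullback {P N E M : C} {fst : P ⟶ N} {snd : P ⟶ E} {f : N ⟶ M} {q : E ⟶ M}
    (hq : 𝕋.IsEtale q) (h : IsTPullback 𝕋.T fst snd f q) : 𝕋.IsEtale fst := by
  have hT : IsTPullback 𝕋.T (𝕋.T.map fst) (𝕋.T.map snd) (𝕋.T.map f) (𝕋.T.map q) := h.iterate 1
  have := hT.paste_vert hq.flip
  have e₁ := 𝕋.p.naturality snd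
  have e₂ := 𝕋.p.naturality f
  simp only [Functor.id_map] at e₁ e₂
  rw [e₁, e₂] at this
  exact (this.of_bot (by simp) h).flip

theorem IsEtale.comp {A B D : C} {m : A ⟶ B} {m' : B ⟶ D} (hm : 𝕋.IsEtale m)
    (hm' : 𝕋.IsEtale m') : 𝕋.IsEtale (m ≫ m') := fun n => by
  simpa using (hm n).paste_vert (hm' n)

theorem IsEtale.of_isIso {A B : C} (e : A ⟶ B) [IsIso e] : 𝕋.IsEtale e :=
  (IsTPullback.of_horiz_isIso (by simp)).flip

theorem Equations.isIso_c (h : 𝕋.Equations) (A : C) : IsIso (𝕋.c.app A) :=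
  ⟨𝕋.c.app A, h.c_c A, h.c_c A⟩

/-- The `T`-image of the étale square has sides `T p`. Pasting it with the naturality square of `c`,
a tangent pullback because `c` is invertible, turns these sides into `p_T`, as `c ≫ T p = p_T`. -/
theorem IsEtale.map (h : 𝕋.Equations) {E M : C} {q : E ⟶ M} (hq : 𝕋.IsEtale q) :
    𝕋.IsEtale (𝕋.T.map q) := by
  have hT : IsTPullback 𝕋.T (𝕋.T.map (𝕋.T.map q)) (𝕋.T.map (𝕋.p.app E)) (𝕋.T.map (𝕋.p.app M))
    (𝕋.T.map q) := (hq.iterate 1).flip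
  have := h.isIso_c E
  have := h.isIso_c M
  have hc : IsTPullback 𝕋.T (𝕋.T.map (𝕋.T.map q)) (𝕋.c.app E) (𝕋.c.app M)
      (𝕋.T.map (𝕋.T.map q)) :=
    (IsTPullback.of_horiz_isIso (𝕋.c.naturality q).symm).flip
  have key := hc.paste_vert hT
  have e : ∀ A, 𝕋.c.app A ≫ 𝕋.T.map (𝕋.p.app A) = 𝕋.p.app (𝕋.T.obj A) := fun A => by
    rw [← h.c_p, ← Category.assoc, h.c_c]
    exact Category.id_comp _
  rw [e, e] at key
  exact key.flip

theorem opens_map (h : 𝕋.Equations) {E M : C} {q : E ⟶ M} (hq : 𝕋.opens q) :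
    𝕋.opens (𝕋.T.map q) := by
  refine ⟨fun n => ?_, fun n => ?_, hq.2.2.map h⟩
  · have := hq.1 (n + 1)
    rw [iter_succ_left] at this
    exact this
  · have := hq.2.1 (n + 1)
    rw [iter_succ_left] at this
    exact this

theorem opens_of_isTPullback {P N E M : C} {fst : P ⟶ N} {snd : P ⟶ E} {f : N ⟶ M} {q : E ⟶ M}
    (h : IsTPullback 𝕋.T fst snd f q) (hq : 𝕋.opens q) : 𝕋.opens fst := by
  refine ⟨fun n => ?_, fun n => (hq.2.1 n).of_isTPullback (h.iterate n),
    hq.2.2.of_isTPullback h⟩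
  have := hq.1 n
  exact (MorphismProperty.monomorphisms C).of_isPullback (h n).flip this

/-- Open monics form a tangent display system of monics. -/
theorem isDisplaySystemOfMonics_opens (h : 𝕋.Equations) :
    𝕋.IsDisplaySystemOfMonics 𝕋.opens where
  mono _ _ m hm := hm.1 0
  etale _ _ m hm := hm.2.2
  system :=
    { admits := fun _ _ q hq => hq.2.1 0
      closed := fun _ _ _ _ _ _ _ _ h hq => opens_of_isTPullback h hq
      map := fun _ _ _ hq => opens_map h hq }
  comp A B D m m' hm hm' := by
    refine ⟨fun n => ?_, fun n => ?_, hm.2.2.comp hm'.2.2⟩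
    · have := hm.1 n
      have := hm'.1 n
      rw [Functor.map_comp]
      infer_instance
    · rw [Functor.map_comp]
      exact (hm.2.1 n).comp (hm'.2.1 n)
  iso A B e _ := ⟨fun n => inferInstance, fun n => AdmitsTPullbacks.of_isIso _,
    IsEtale.of_isIso e⟩

theorem IsDisplaySystemOfMonics.map_iter {M : MorphismProperty C}
    (h : 𝕋.IsDisplaySystemOfMonics M) {A B : C} {m : A ⟶ B} (hm : M m) (n : ℕ) :
    M ((iter 𝕋.T n).map m) := by
  induction n with
  | zero => exact hm
  | succ n ih => exact h.system.map _ ih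

/-- Open monics contain every tangent display system of monics. -/
theorem IsDisplaySystemOfMonics.le_opens {M : MorphismProperty C}
    (h : 𝕋.IsDisplaySystemOfMonics M) : M ≤ 𝕋.opens := fun _ _ m hm =>
  ⟨fun n => h.mono _ (h.map_iter hm n), fun n => h.system.admits _ (h.map_iter hm n),
    h.etale m hm⟩

end TangentData

/-! ### Calculus of partial maps -/

namespace Par

open HasRestriction

variable {C : Type u} [Category.{v} C] {M : MorphismProperty C} (hM : IsDisplaySystemOfMonics M)

/-- The partial map given by a span, as a morphism between images of the inclusion. -/
def ofSpan {A B D : C} (m : D ⟶ A) (hm : M m) (f : D ⟶ B) :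
    (incl hM).obj A ⟶ (incl hM).obj B :=
  homMk hM ⟨D, m, f, hm⟩

theorem ofSpan_eq_ofSpan {A B D D' : C} {m : D ⟶ A} {hm : M m} {f : D ⟶ B}
    {m' : D' ⟶ A} {hm' : M m'} {f' : D' ⟶ B} (e : D ≅ D') (h₁ : e.hom ≫ m' = m) (h₂ : e.hom ≫ f' = f) :
    ofSpan hM m hm f = ofSpan hM m' hm' f' :=
  MSpan.toHom_eq e h₁ h₂

theorem exists_iso_of_ofSpan_eq_ofSpan {A B D D' : C} {m : D ⟶ A} {hm : M m} {f : D ⟶ B}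
    {m' : D' ⟶ A} {hm' : M m'} {f' : D' ⟶ B} (h : ofSpan hM m hm f = ofSpan hM m' hm' f') :
    ∃ e : D ≅ D', e.hom ≫ m' = m ∧ e.hom ≫ f' = f :=
  Quotient.exact h

theorem exists_eq_ofSpan {A B : C} (f : (incl hM).obj A ⟶ (incl hM).obj B) :
    ∃ (D : C) (m : D ⟶ A) (hm : M m) (g : D ⟶ B), f = ofSpan hM m hm g := by
  obtain ⟨f⟩ := f
  exact ⟨f.dom, f.incl, f.mem, f.map, rfl⟩

theorem incl_map_eq_ofSpan {A B : C} (f : A ⟶ B) :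
    (incl hM).map f = ofSpan hM (𝟙 A) (hM.iso _ inferInstance) f := rfl

theorem ofSpan_comp_ofSpan {A B D X Y P : C} {m : X ⟶ A} {hm : M m} {f : X ⟶ B}
    {n : Y ⟶ B} {hn : M n} {g : Y ⟶ D} {a : P ⟶ X} {b : P ⟶ Y} (h : IsPullback a b f n) :
    ofSpan hM m hm f ≫ ofSpan hM n hn g =
      ofSpan hM (a ≫ m) (hM.comp _ _ (hM.closed _ _ _ _ h hn) hm) (b ≫ g) :=
  MSpan.comp_toHom_eq hM ⟨X, m, f, hm⟩ ⟨Y, n, g, hn⟩ a b h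
    ⟨P, a ≫ m, b ≫ g, hM.comp _ _ (hM.closed _ _ _ _ h hn) hm⟩ (Iso.refl _)
    (Category.id_comp _).symm (Category.id_comp _).symm

theorem ofSpan_comp_incl {A B D X : C} (m : X ⟶ A) (hm : M m) (f : X ⟶ B) (g : B ⟶ D) :
    ofSpan hM m hm f ≫ (incl hM).map g = ofSpan hM m hm (f ≫ g) := by
  rw [incl_map_eq_ofSpan,
    ofSpan_comp_ofSpan hM (IsPullback.of_horiz_isIso (fst := 𝟙 X) (snd := f) ⟨by simp⟩)]
  simp only [Category.id_comp]

theorem incl_comp_ofSpan {A B D P X : C} {g : A ⟶ B} {m : X ⟶ B} {hm : M m} {f : X ⟶ D} {a : P ⟶ A}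
    {b : P ⟶ X} (h : IsPullback a b g m) :
    (incl hM).map g ≫ ofSpan hM m hm f = ofSpan hM a (hM.closed _ _ _ _ h hm) (b ≫ f) := by
  rw [incl_map_eq_ofSpan, ofSpan_comp_ofSpan hM h]
  simp only [Category.comp_id]

theorem rst_ofSpan {A B D : C} (m : D ⟶ A) (hm : M m) (f : D ⟶ B) :
    rst (ofSpan hM m hm f) = ofSpan hM m hm m := rfl

theorem isTotal_incl {A B : C} (f : A ⟶ B) : IsTotal ((incl hM).map f) := rfl

/-- An isomorphism of the two spans is an automorphism of `D` over the monic `m`, hence the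
identity. This is how equations between partial maps descend to `C`. -/
theorem ofSpan_injective {A B D : C} {m : D ⟶ A} {hm : M m} {f g : D ⟶ B}
    (h : ofSpan hM m hm f = ofSpan hM m hm g) : f = g := by
  have := hM.mono m hm
  obtain ⟨e, h₁, h₂⟩ := exists_iso_of_ofSpan_eq_ofSpan hM h
  have : e.hom = 𝟙 D := by
    rw [← cancel_mono m, h₁, Category.id_comp]
  rw [← h₂, this, Category.id_comp]

theorem incl_map_injective {A B : C} {f g : A ⟶ B} (h : (incl hM).map f = (incl hM).map g) :
    f = g :=
  ofSpan_injective hM h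

theorem rst_comp_incl {A B D : C} (f : (incl hM).obj A ⟶ (incl hM).obj B) (g : B ⟶ D) :
    rst (f ≫ (incl hM).map g) = rst f := by
  obtain ⟨X, m, hm, f, rfl⟩ := exists_eq_ofSpan hM f
  rw [ofSpan_comp_incl, rst_ofSpan, rst_ofSpan]

/-- A partial map with the domain of definition `m` is determined by a morphism out of `m`. -/
theorem exists_of_rst_eq {A B D : C} {m : D ⟶ A} {hm : M m}
    {f : (incl hM).obj A ⟶ (incl hM).obj B} (h : rst f = ofSpan hM m hm m) :
    ∃ g : D ⟶ B, f = ofSpan hM m hm g := by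
  obtain ⟨X, n, hn, f, rfl⟩ := exists_eq_ofSpan hM f
  rw [rst_ofSpan] at h
  obtain ⟨e, h₁, -⟩ := exists_iso_of_ofSpan_eq_ofSpan hM h
  exact ⟨e.inv ≫ f, ofSpan_eq_ofSpan hM e h₁ (by simp)⟩

/-- A total map after `f` leaves its domain unchanged. This puts partial maps linked by an equation
on one common domain. -/
theorem exists_of_comp_incl_eq {A B D E : C} {m : D ⟶ A} {hm : M m}
    {f : (incl hM).obj A ⟶ (incl hM).obj B} {g : B ⟶ E} {g' : D ⟶ E}
    (h : f ≫ (incl hM).map g = ofSpan hM m hm g') :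
    ∃ k : D ⟶ B, f = ofSpan hM m hm k := by
  apply exists_of_rst_eq
  rw [← rst_comp_incl hM f g, h, rst_ofSpan]

theorem rst_comp_self {A B : C} (f : (incl hM).obj A ⟶ (incl hM).obj B) : rst f ≫ f = f := by
  obtain ⟨D, m, hm, f, rfl⟩ := exists_eq_ofSpan hM f
  have := hM.mono m hm
  rw [rst_ofSpan, ofSpan_comp_ofSpan hM (IsKernelPair.id_of_mono m)]
  simp only [Category.id_comp]

theorem rst_comm {A B D : C} (f : (incl hM).obj A ⟶ (incl hM).obj B)
    (g : (incl hM).obj A ⟶ (incl hM).obj D) : rst f ≫ rst g = rst g ≫ rst f := by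
  obtain ⟨X, m, hm, f, rfl⟩ := exists_eq_ofSpan hM f
  obtain ⟨Y, n, hn, g, rfl⟩ := exists_eq_ofSpan hM g
  have := hM.display n hn m
  have h := IsPullback.of_hasPullback m n
  rw [rst_ofSpan, rst_ofSpan, ofSpan_comp_ofSpan hM h, ofSpan_comp_ofSpan hM h.flip]
  simp only [h.w]

theorem rst_rst_comp {A B D : C} (f : (incl hM).obj A ⟶ (incl hM).obj B)
    (g : (incl hM).obj A ⟶ (incl hM).obj D) : rst (rst f ≫ g) = rst f ≫ rst g := by
  obtain ⟨X, m, hm, f, rfl⟩ := exists_eq_ofSpan hM f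
  obtain ⟨Y, n, hn, g, rfl⟩ := exists_eq_ofSpan hM g
  have := hM.display n hn m
  have h := IsPullback.of_hasPullback m n
  rw [rst_ofSpan, rst_ofSpan, ofSpan_comp_ofSpan hM h, ofSpan_comp_ofSpan hM h, rst_ofSpan]
  simp only [h.w]

theorem comp_rst {A B D : C} (f : (incl hM).obj A ⟶ (incl hM).obj B)
    (g : (incl hM).obj B ⟶ (incl hM).obj D) : f ≫ rst g = rst (f ≫ g) ≫ f := by
  obtain ⟨X, m, hm, f, rfl⟩ := exists_eq_ofSpan hM f
  obtain ⟨Y, n, hn, g, rfl⟩ := exists_eq_ofSpan hM g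
  have := hM.display n hn f
  have := hM.mono m hm
  have h := IsPullback.of_hasPullback f n
  -- The domain of the composite lies inside the domain `m` of the first map, so intersecting it
  -- with `m` changes nothing.
  have h' : IsPullback (𝟙 _) (pullback.fst f n) (pullback.fst f n ≫ m) m := by
    simpa only [Category.comp_id] using
      (IsPullback.of_horiz_isIso (fst := 𝟙 _) (g := 𝟙 X) ⟨by simp⟩).paste_vert
        (IsKernelPair.id_of_mono m)
  rw [rst_ofSpan, ofSpan_comp_ofSpan hM h, ofSpan_comp_ofSpan hM h, rst_ofSpan,
    ofSpan_comp_ofSpan hM h']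
  simp only [h.w, Category.id_comp]

theorem split {A B : C} (f : (incl hM).obj A ⟶ (incl hM).obj B) :
    ∃ (S : C) (i : (incl hM).obj S ⟶ (incl hM).obj A) (r : (incl hM).obj A ⟶ (incl hM).obj S),
      i ≫ r = 𝟙 _ ∧ r ≫ i = rst f := by
  obtain ⟨D, m, hm, f, rfl⟩ := exists_eq_ofSpan hM f
  have := hM.mono m hm
  -- The domain of definition splits the idempotent: include it totally by `m`, and retract by the
  -- partial inverse `[m, 𝟙]`.
  refine ⟨D, (incl hM).map m, ofSpan hM m hm (𝟙 D), ?_, ?_⟩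
  · rw [incl_comp_ofSpan hM (IsKernelPair.id_of_mono m)]
    simp only [Category.id_comp]
    rfl
  · rw [ofSpan_comp_incl, rst_ofSpan, Category.id_comp]

/-- Partial maps form a restriction category. -/
theorem isRestrictionCategory : IsRestrictionCategory (Par hM) where
  -- By structure eta, every object of `Par hM` is definitionally in the image of `incl`.
  rst_comp_self {A B} f := rst_comp_self (A := A.of) (B := B.of) hM f
  rst_comm {A B D} f g := rst_comm (A := A.of) (B := B.of) (D := D.of) hM f g
  rst_rst_comp {A B D} f g := rst_rst_comp (A := A.of) (B := B.of) (D := D.of) hM f g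
  comp_rst {A B D} f g := comp_rst (A := A.of) (B := B.of) (D := D.of) hM f g

/-- Partial maps form a split restriction category. -/
theorem isSplitRestrictionCategory : IsSplitRestrictionCategory (Par hM) where
  toIsRestrictionCategory := isRestrictionCategory hM
  split A B f := by
    obtain ⟨S, i, r, h⟩ := split (A := A.of) (B := B.of) hM f
    exact ⟨_, i, r, h⟩

theorem isTotal_iff {A B : C} (g : (incl hM).obj A ⟶ (incl hM).obj B) :
    IsTotal g ↔ ∃ f : A ⟶ B, (incl hM).map f = g := by
  refine ⟨fun h => ?_, ?_⟩
  -- The identity partial map is by definition `[𝟙, 𝟙]`, so totality says that the domain of `g` is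
  -- `𝟙 A`.
  · obtain ⟨f, rfl⟩ := exists_of_rst_eq hM (f := g) (m := 𝟙 A) (hm := hM.iso _ inferInstance) h
    exact ⟨f, rfl⟩
  · rintro ⟨f, rfl⟩
    exact isTotal_incl hM f

end Par

/-! ### Transformations cartesian at the chosen monics -/

section Cartesian

variable {C : Type u} [Category.{v} C] {M : MorphismProperty C}

/-- The naturality squares of `α` at the members of `M` are pullbacks. -/
def CartesianOn {F G : C ⥤ C} (α : F ⟶ G) (M : MorphismProperty C) : Prop :=
  ∀ ⦃A B : C⦄ (m : A ⟶ B), M m → IsPullback (F.map m) (α.app A) (α.app B) (G.map m)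

theorem CartesianOn.of_comp {F G H : C ⥤ C} {α : F ⟶ G} {β : G ⟶ H}
    {γ : F ⟶ H} (hγ : CartesianOn γ M) (hβ : CartesianOn β M)
    (w : ∀ A, α.app A ≫ β.app A = γ.app A) : CartesianOn α M := fun A B m hm =>
  IsPullback.of_bot (by rw [w, w]; exact hγ m hm) (α.naturality m) (hβ m hm)

/-- `F` preserves members of `M` and their pullbacks. -/
structure PreservesSpans (F : C ⥤ C) (M : MorphismProperty C) : Prop where
  map_mem : ∀ ⦃A B : C⦄ (m : A ⟶ B), M m → M (F.map m)
  map_isPullback : ∀ ⦃P A D B : C⦄ (a : P ⟶ A) (b : P ⟶ D) (f : A ⟶ B) (m : D ⟶ B),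
    IsPullback a b f m → M m → IsPullback (F.map a) (F.map b) (F.map f) (F.map m)

/-- The square of `ε` at `m` exhibits `F m` as a pullback of `m`. For a pullback of `m`, paste it
below the square of `ε` at its left leg, rewrite the sides by naturality, and cancel the square of
`ε` at `m`. -/
theorem CartesianOn.preservesSpans (hM : IsDisplaySystemOfMonics M) {F : C ⥤ C}
    {ε : F ⟶ 𝟭 C} (hε : CartesianOn ε M) : PreservesSpans F M where
  map_mem A B m hm := hM.closed _ _ _ _ (hε m hm) hm
  map_isPullback P A D B a b f m h hm := by
    refine IsPullback.of_bot ?_ (by rw [← F.map_comp, h.w, F.map_comp]) (hε m hm)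
    have := (hε a (hM.closed _ _ _ _ h hm)).paste_vert h
    have e₁ := ε.naturality b
    have e₂ := ε.naturality f
    rw [e₁, e₂]
    exact this

end Cartesian

namespace Par

open HasRestriction

/-! ### From limits in the base to restriction limits of partial maps -/

section RestrictionLimits

variable {C : Type u} [Category.{v} C] {M : MorphismProperty C} (hM : IsDisplaySystemOfMonics M)

/-- If `f ≫ g ≤ d` with `g` total, then `f ≫ g` and `d` agree on every domain contained in that
of `f`. -/
theorem comp_comp_incl_eq_of_rLe {A B D : C} {f : (incl hM).obj A ⟶ (incl hM).obj B} {g : B ⟶ D}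
    {d : (incl hM).obj A ⟶ (incl hM).obj D} (h : RLe (f ≫ (incl hM).map g) d)
    {e : (incl hM).obj A ⟶ (incl hM).obj A} (he : e ≫ rst f = e) :
    (e ≫ f) ≫ (incl hM).map g = e ≫ d := by
  have h : rst (f ≫ (incl hM).map g) ≫ d = f ≫ (incl hM).map g := h
  rw [rst_comp_incl] at h
  rw [Category.assoc, ← h, ← Category.assoc, he]

theorem rst_rst {A B : C} (f : (incl hM).obj A ⟶ (incl hM).obj B) : rst (rst f) = rst f := by
  obtain ⟨D, m, hm, f, rfl⟩ := exists_eq_ofSpan hM f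
  rfl

theorem rst_comp_rst_self {A B : C} (f : (incl hM).obj A ⟶ (incl hM).obj B) :
    rst f ≫ rst f = rst f := by
  have := rst_comp_self hM (rst f)
  rwa [rst_rst] at this

theorem rst_comp_of_le {A B : C} {e : (incl hM).obj A ⟶ (incl hM).obj A}
    {f : (incl hM).obj A ⟶ (incl hM).obj B} (he' : rst e = e) (he : e ≫ rst f = e) :
    rst (e ≫ f) = e := by
  conv_lhs => rw [← he']
  rw [rst_rst_comp, he', he]

/-- Pullback squares are sent to restriction pullbacks. -/
theorem isRestrictionPullback_incl {P A B D : C} {fst : P ⟶ A} {snd : P ⟶ B} {f : A ⟶ D}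
    {g : B ⟶ D} (h : IsPullback fst snd f g) :
    IsRestrictionPullback ((incl hM).map fst) ((incl hM).map snd) ((incl hM).map f)
      ((incl hM).map g) := by
  have lift : ∀ {Y : C} (a : (incl hM).obj Y ⟶ (incl hM).obj A)
      (b : (incl hM).obj Y ⟶ (incl hM).obj B) (d : (incl hM).obj Y ⟶ (incl hM).obj D),
      RLe (a ≫ (incl hM).map f) d → RLe (b ≫ (incl hM).map g) d →
      ∃! k : (incl hM).obj Y ⟶ (incl hM).obj P, RLe (k ≫ (incl hM).map fst) a ∧
        RLe (k ≫ (incl hM).map snd) b ∧ RLe (k ≫ (incl hM).map fst ≫ (incl hM).map f) d ∧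
        rst k = rst a ≫ rst b ≫ rst d := by
    intro Y a b d ha hb
    -- `e` is the intersection of the three domains. On it the lax cone commutes strictly, since
    -- both composites restrict to `e ≫ d`.
    obtain ⟨e, he⟩ : ∃ e, e = rst a ≫ rst b ≫ rst d := ⟨_, rfl⟩
    have he' : rst e = e := by
      rw [he, ← rst_rst_comp, ← rst_rst_comp, rst_rst]
    have hea : e ≫ rst a = e := by
      rw [he, ← rst_rst_comp hM b d, rst_comm hM a, Category.assoc, rst_comp_rst_self]
    have heb : e ≫ rst b = e := by
      rw [he, rst_comm hM b d, Category.assoc, Category.assoc, rst_comp_rst_self]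
    have hed : e ≫ rst d = e := by
      rw [he, Category.assoc, Category.assoc, rst_comp_rst_self]
    obtain ⟨E, m, hm, e₀, he₀⟩ := exists_eq_ofSpan hM e
    have hm' : e = ofSpan hM m hm m := by rw [← he', he₀, rst_ofSpan]
    obtain ⟨a₀, ha₀⟩ := exists_of_rst_eq hM ((rst_comp_of_le hM he' hea).trans hm')
    obtain ⟨b₀, hb₀⟩ := exists_of_rst_eq hM ((rst_comp_of_le hM he' heb).trans hm')
    have haf := comp_comp_incl_eq_of_rLe hM ha hea
    have hbg := comp_comp_incl_eq_of_rLe hM hb heb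
    rw [ha₀, ofSpan_comp_incl] at haf
    rw [hb₀, ofSpan_comp_incl] at hbg
    have w : a₀ ≫ f = b₀ ≫ g := ofSpan_injective hM (haf.trans hbg.symm)
    refine ⟨ofSpan hM m hm (h.lift a₀ b₀ w), ⟨?_, ?_, ?_, ?_⟩, ?_⟩
    · change rst _ ≫ a = _
      rw [ofSpan_comp_incl, rst_ofSpan, ← hm', ha₀, h.lift_fst]
    · change rst _ ≫ b = _
      rw [ofSpan_comp_incl, rst_ofSpan, ← hm', hb₀, h.lift_snd]
    · change rst _ ≫ d = _
      rw [← Functor.map_comp, ofSpan_comp_incl, rst_ofSpan, ← hm', ← haf, h.lift_fst_assoc]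
    · rw [rst_ofSpan, ← hm', he]
    -- The prescribed restriction fixes the domain of `k` as `m`; the inequalities then become
    -- equations for its two components.
    · rintro k ⟨h₁, h₂, -, h₄⟩
      change rst (k ≫ _) ≫ a = _ at h₁
      change rst (k ≫ _) ≫ b = _ at h₂
      rw [rst_comp_incl, h₄, ← he] at h₁ h₂
      obtain ⟨k₀, rfl⟩ := exists_of_rst_eq hM ((h₄.trans he.symm).trans hm')
      rw [ha₀, ofSpan_comp_incl] at h₁
      rw [hb₀, ofSpan_comp_incl] at h₂
      congr 1
      apply h.hom_ext
      · rw [h.lift_fst, ofSpan_injective hM h₁]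
      · rw [h.lift_snd, ofSpan_injective hM h₂]
  exact
    { w := by rw [← Functor.map_comp, h.w, Functor.map_comp]
      total_fst := isTotal_incl hM fst
      total_snd := isTotal_incl hM snd
      total_comp := by
        rw [← Functor.map_comp]
        exact isTotal_incl hM _
      lift := fun Y a b d => lift (Y := Y.of) a b d }

/-- The fold is the meet of the restriction idempotents involved. These three properties are all
that the power construction needs of it, so the fold can be generalized away there. -/
theorem foldr_rst_le {Y B D : C} (l : List ((incl hM).obj Y ⟶ (incl hM).obj B))
    (d : (incl hM).obj Y ⟶ (incl hM).obj D) :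
    rst (l.foldr (fun b e => rst b ≫ e) (rst d)) = l.foldr (fun b e => rst b ≫ e) (rst d) ∧
      l.foldr (fun b e => rst b ≫ e) (rst d) ≫ rst d =
        l.foldr (fun b e => rst b ≫ e) (rst d) ∧
      ∀ a ∈ l, l.foldr (fun b e => rst b ≫ e) (rst d) ≫ rst a =
        l.foldr (fun b e => rst b ≫ e) (rst d) := by
  induction l with
  | nil => exact ⟨rst_rst hM d, rst_comp_rst_self hM d, by simp⟩
  | cons b l ih =>
    simp only [List.foldr_cons]
    generalize l.foldr (fun b e => rst b ≫ e) (rst d) = e at ih ⊢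
    obtain ⟨h₁, h₂, h₃⟩ := ih
    refine ⟨?_, ?_, ?_⟩
    · rw [rst_rst_comp, h₁]
    · rw [Category.assoc, h₂]
    · intro a ha
      rcases List.mem_cons.1 ha with rfl | ha
      · rw [← h₁, rst_comm hM a, Category.assoc, rst_comp_rst_self]
      · rw [Category.assoc, h₃ a ha]

/-- Pullback powers are sent to restriction pullback powers. -/
theorem isRestrictionPullbackPower_incl {E N P : C} {n : ℕ} {q : E ⟶ N} {base : P ⟶ N}
    {π : Fin n → (P ⟶ E)} (h : IsPullbackPower q base π) :
    IsRestrictionPullbackPower ((incl hM).map q) ((incl hM).map base)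
      (fun i => (incl hM).map (π i)) := by
  obtain ⟨w, ⟨hl⟩⟩ := h
  have lift : ∀ {Y : C} (d : (incl hM).obj Y ⟶ (incl hM).obj N)
      (a : Fin n → ((incl hM).obj Y ⟶ (incl hM).obj E)),
      (∀ i, RLe (a i ≫ (incl hM).map q) d) →
      ∃! k : (incl hM).obj Y ⟶ (incl hM).obj P, RLe (k ≫ (incl hM).map base) d ∧
        (∀ i, RLe (k ≫ (incl hM).map (π i)) (a i)) ∧
        rst k = (List.ofFn a).foldr (fun b e => rst b ≫ e) (rst d) := by
    intro Y d a ha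
    have hfold := foldr_rst_le hM (List.ofFn a) d
    generalize (List.ofFn a).foldr (fun b e => rst b ≫ e) (rst d) = e at hfold ⊢
    obtain ⟨he', hed, hea⟩ := hfold
    replace hea : ∀ i, e ≫ rst (a i) = e := fun i => hea _ (List.mem_ofFn.2 ⟨i, rfl⟩)
    obtain ⟨X, m, hm, e₀, he₀⟩ := exists_eq_ofSpan hM e
    have hm' : e = ofSpan hM m hm m := by rw [← he', he₀, rst_ofSpan]
    obtain ⟨d₀, hd₀⟩ := exists_of_rst_eq hM ((rst_comp_of_le hM he' hed).trans hm')
    have := fun i => exists_of_rst_eq hM ((rst_comp_of_le hM he' (hea i)).trans hm')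
    choose a₀ ha₀ using this
    have w₀ : ∀ i, a₀ i ≫ q = d₀ := fun i => by
      have := comp_comp_incl_eq_of_rLe hM (ha i) (hea i)
      rw [ha₀, ofSpan_comp_incl, hd₀] at this
      exact ofSpan_injective hM this
    obtain ⟨k, hk₁, hk₂⟩ : ∃ k : X ⟶ P, k ≫ base = d₀ ∧ ∀ i, k ≫ π i = a₀ i :=
      ⟨hl.lift (WidePullbackCone.mk d₀ a₀ w₀),
        hl.fac (WidePullbackCone.mk d₀ a₀ w₀) none,
        fun i => hl.fac (WidePullbackCone.mk d₀ a₀ w₀) (some i)⟩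
    refine ⟨ofSpan hM m hm k, ⟨?_, fun i => ?_, ?_⟩, ?_⟩
    · change rst _ ≫ d = _
      rw [ofSpan_comp_incl, rst_ofSpan, ← hm', hd₀, hk₁]
    · change rst _ ≫ a i = _
      rw [ofSpan_comp_incl, rst_ofSpan, ← hm', ha₀, hk₂]
    · rw [rst_ofSpan, ← hm']
    · rintro k' ⟨h₁, h₂, h₃⟩
      change rst (k' ≫ _) ≫ d = _ at h₁
      replace h₂ : ∀ i, rst (k' ≫ (incl hM).map (π i)) ≫ a i = k' ≫ (incl hM).map (π i) := h₂
      simp only [rst_comp_incl, h₃] at h₁ h₂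
      obtain ⟨k₀, rfl⟩ := exists_of_rst_eq hM (h₃.trans hm')
      rw [hd₀, ofSpan_comp_incl] at h₁
      congr 1
      refine hl.hom_ext ?_
      -- The leg `none` is the base; when `n = 0` it is the only one.
      rintro (_ | i)
      · exact (ofSpan_injective hM h₁).symm.trans hk₁.symm
      · have := h₂ i
        rw [ha₀, ofSpan_comp_incl] at this
        exact (ofSpan_injective hM this).symm.trans (hk₂ i).symm
  exact
    { w := fun i => by rw [← Functor.map_comp, w]
      total_base := isTotal_incl hM _
      total_π := fun i => isTotal_incl hM _
      lift := fun Y d a => lift (Y := Y.of) d a }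

end RestrictionLimits

/-! ### Extension of functors to partial maps -/

section Extension

variable {C : Type u} [Category.{v} C] {M : MorphismProperty C}

variable (hM : IsDisplaySystemOfMonics M)

/-- The extension of a functor to partial maps, `[m, f] ↦ [F m, F f]`. -/
def extend {F : C ⥤ C} (hF : PreservesSpans F M) : Par hM ⥤ Par hM where
  obj A := ⟨F.obj A.of⟩
  map {A B} f := Quotient.lift
    (fun f : MSpan M A.of B.of =>
      (⟨F.obj f.dom, F.map f.incl, F.map f.map, hF.map_mem _ f.mem⟩ :
        MSpan M (F.obj A.of) (F.obj B.of)).toHom)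
    (by
      rintro f g ⟨e, h₁, h₂⟩
      exact MSpan.toHom_eq (F.mapIso e) (by simp [← h₁]) (by simp [← h₂])) f
  map_id A := MSpan.toHom_eq (Iso.refl _) ((Category.id_comp _).trans (F.map_id _).symm)
    ((Category.id_comp _).trans (F.map_id _).symm)
  map_comp := by
    rintro A B D ⟨f⟩ ⟨g⟩
    have := hM.display g.incl g.mem f.map
    exact (MSpan.comp_toHom_eq hM
      ⟨F.obj f.dom, F.map f.incl, F.map f.map, hF.map_mem _ f.mem⟩
      ⟨F.obj g.dom, F.map g.incl, F.map g.map, hF.map_mem _ g.mem⟩ _ _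
      (hF.map_isPullback _ _ _ _ (IsPullback.of_hasPullback f.map g.incl) g.mem)
      ⟨F.obj (pullback f.map g.incl), F.map (pullback.fst f.map g.incl ≫ f.incl),
        F.map (pullback.snd f.map g.incl ≫ g.map), hF.map_mem _ (f.comp hM g).mem⟩ (Iso.refl _)
      (by simp) (by simp)).symm

theorem extend_map_incl {F : C ⥤ C} (hF : PreservesSpans F M) {A B : C} (f : A ⟶ B) :
    (extend hM hF).map ((incl hM).map f) = (incl hM).map (F.map f) :=
  MSpan.toHom_eq (Iso.refl _) ((Category.id_comp _).trans (F.map_id _).symm) (Category.id_comp _)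

theorem incl_comp_extend {F : C ⥤ C} (hF : PreservesSpans F M) :
    incl hM ⋙ extend hM hF = F ⋙ incl hM :=
  CategoryTheory.Functor.ext (fun _ => rfl) fun _ _ f =>
    (extend_map_incl hM hF f).trans ((Category.id_comp _).trans (Category.comp_id _)).symm

/-- Preservation of restriction limits by iterates of the extension thereby reduces to preservation
of limits by iterates of `F`. -/
theorem incl_comp_iter_extend {F : C ⥤ C} (hF : PreservesSpans F M) (n : ℕ) :
    incl hM ⋙ iter (extend hM hF) n = iter F n ⋙ incl hM := by
  induction n with
  | zero => rfl
  | succ n ih =>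
    change (incl hM ⋙ iter (extend hM hF) n) ⋙ extend hM hF = iter F n ⋙ F ⋙ incl hM
    rw [ih, ← incl_comp_extend hM hF]
    rfl

/-- Naturality of a cartesian transformation with respect to partial maps. -/
theorem naturality_of_cartesianOn {F G : C ⥤ C} (hF : ∀ ⦃A B : C⦄ (m : A ⟶ B), M m → M (F.map m))
    (hG : ∀ ⦃A B : C⦄ (m : A ⟶ B), M m → M (G.map m)) {α : F ⟶ G} (hα : CartesianOn α M)
    {A B : C} (f : MSpan M A B) :
    ofSpan hM (F.map f.incl) (hF _ f.mem) (F.map f.map) ≫ (incl hM).map (α.app B) =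
      (incl hM).map (α.app A) ≫ ofSpan hM (G.map f.incl) (hG _ f.mem) (G.map f.map) := by
  rw [ofSpan_comp_incl, incl_comp_ofSpan hM (hα f.incl f.mem), α.naturality]

theorem isRestrictionTPullback_incl {F : C ⥤ C} (hF : PreservesSpans F M) {P A B D : C}
    {fst : P ⟶ A} {snd : P ⟶ B} {f : A ⟶ D} {g : B ⟶ D} (h : IsTPullback F fst snd f g) :
    IsRestrictionTPullback (extend hM hF) ((incl hM).map fst) ((incl hM).map snd)
      ((incl hM).map f) ((incl hM).map g) := fun n => by
  -- With the functor as a variable, the equality of functors is substituted in all four maps and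
  -- their types at once.
  have key : ∀ G : C ⥤ Par hM, G = iter F n ⋙ incl hM →
      IsRestrictionPullback (G.map fst) (G.map snd) (G.map f) (G.map g) := by
    rintro G rfl
    exact isRestrictionPullback_incl hM (h n)
  exact key _ (incl_comp_iter_extend hM hF n)

theorem isRestrictionPullbackPower_iter_incl {F : C ⥤ C} (hF : PreservesSpans F M) {E N P : C}
    {k : ℕ} {q : E ⟶ N} {base : P ⟶ N} {π : Fin k → (P ⟶ E)} (n : ℕ)
    (h : IsPullbackPower ((iter F n).map q) ((iter F n).map base)
      (fun i => (iter F n).map (π i))) :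
    IsRestrictionPullbackPower ((iter (extend hM hF) n).map ((incl hM).map q))
      ((iter (extend hM hF) n).map ((incl hM).map base))
      (fun i => (iter (extend hM hF) n).map ((incl hM).map (π i))) := by
  have key : ∀ G : C ⥤ Par hM, G = iter F n ⋙ incl hM →
      IsRestrictionPullbackPower (G.map q) (G.map base) (fun i => G.map (π i)) := by
    rintro G rfl
    exact isRestrictionPullbackPower_incl hM h
  exact key _ (incl_comp_iter_extend hM hF n)

end Extension

end Par

namespace TangentData

variable {C : Type u} [Category.{v} C] {𝕋 : TangentData C} {M : MorphismProperty C}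

/-! ### Cartesian naturality squares of the structural transformations -/

theorem cartesianOn_id (M : MorphismProperty C) : CartesianOn (𝟙 (𝟭 C)) M := fun _ _ _ _ =>
  IsPullback.of_vert_isIso ⟨by simp⟩

theorem IsDisplaySystemOfMonics.cartesianOn_p (hM : 𝕋.IsDisplaySystemOfMonics M) :
    CartesianOn 𝕋.p M := fun _ _ m hm => (hM.etale m hm).isPullback.flip

/-- The projection against which `l` and `c` are cancelled. -/
theorem IsDisplaySystemOfMonics.cartesianOn_p_p (hM : 𝕋.IsDisplaySystemOfMonics M) :
    CartesianOn (Functor.whiskerLeft 𝕋.T 𝕋.p ≫ 𝕋.p : 𝕋.T ⋙ 𝕋.T ⟶ 𝟭 C) M := fun _ _ m hm =>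
  (hM.cartesianOn_p _ (hM.system.map m hm)).paste_vert (hM.cartesianOn_p m hm)

/-- The pullback square defining `T2 A`, pasted with the étale square of `m`, is by naturality also
the square of `π₁` at `m` pasted with the one defining `T2 B`, which cancels. -/
theorem IsDisplaySystemOfMonics.cartesianOn_π₁ (hM : 𝕋.IsDisplaySystemOfMonics M)
    (h : 𝕋.IsTangent) : CartesianOn 𝕋.π₁ M := fun A B m hm => by
  have key := (h.T2_pullback A).isPullback.paste_vert (hM.etale m hm).isPullback
  have e := 𝕋.p.naturality m
  simp only [Functor.id_map] at e
  rw [← e, ← 𝕋.π₂.naturality m] at key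
  exact (key.of_bot (𝕋.π₁.naturality m).symm (h.T2_pullback B).isPullback).flip

theorem IsDisplaySystemOfMonics.cartesianOn_π₁_p (hM : 𝕋.IsDisplaySystemOfMonics M)
    (h : 𝕋.IsTangent) : CartesianOn (𝕋.π₁ ≫ 𝕋.p) M := fun _ _ m hm =>
  (hM.cartesianOn_π₁ h m hm).paste_vert (hM.cartesianOn_p m hm)

theorem IsDisplaySystemOfMonics.cartesianOn_π₂ (hM : 𝕋.IsDisplaySystemOfMonics M)
    (h : 𝕋.IsTangent) : CartesianOn 𝕋.π₂ M :=
  (hM.cartesianOn_π₁_p h).of_comp hM.cartesianOn_p fun A => (h.T2_pullback A).isPullback.w.symm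

theorem IsDisplaySystemOfMonics.cartesianOn_s (hM : 𝕋.IsDisplaySystemOfMonics M)
    (h : 𝕋.IsTangent) : CartesianOn 𝕋.s M :=
  (hM.cartesianOn_π₁_p h).of_comp hM.cartesianOn_p h.s_p

theorem IsDisplaySystemOfMonics.cartesianOn_z (hM : 𝕋.IsDisplaySystemOfMonics M)
    (h : 𝕋.IsTangent) : CartesianOn 𝕋.z M :=
  (cartesianOn_id M).of_comp hM.cartesianOn_p h.z_p

/-- Before a further `p`, naturality trades `p_T` for `T p`; then `l ≫ T p = p ≫ z` and `z ≫ p = 𝟙`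
give `l ≫ p_T ≫ p = p`. -/
theorem IsDisplaySystemOfMonics.cartesianOn_l (hM : 𝕋.IsDisplaySystemOfMonics M)
    (h : 𝕋.IsTangent) : CartesianOn 𝕋.l M :=
  hM.cartesianOn_p.of_comp hM.cartesianOn_p_p fun A => by
    have e : 𝕋.T.map (𝕋.p.app A) ≫ 𝕋.p.app A = 𝕋.p.app (𝕋.T.obj A) ≫ 𝕋.p.app A :=
      𝕋.p.naturality (𝕋.p.app A)
    change 𝕋.l.app A ≫ 𝕋.p.app (𝕋.T.obj A) ≫ 𝕋.p.app A = 𝕋.p.app A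
    rw [← e, ← Category.assoc, h.l_p, Category.assoc, h.z_p]
    exact Category.comp_id _

theorem IsDisplaySystemOfMonics.cartesianOn_c (hM : 𝕋.IsDisplaySystemOfMonics M)
    (h : 𝕋.IsTangent) : CartesianOn 𝕋.c M :=
  hM.cartesianOn_p_p.of_comp hM.cartesianOn_p_p fun A => by
    have e : 𝕋.T.map (𝕋.p.app A) ≫ 𝕋.p.app A = 𝕋.p.app (𝕋.T.obj A) ≫ 𝕋.p.app A :=
      𝕋.p.naturality (𝕋.p.app A)
    change 𝕋.c.app A ≫ 𝕋.p.app (𝕋.T.obj A) ≫ 𝕋.p.app A = 𝕋.p.app (𝕋.T.obj A) ≫ 𝕋.p.app A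
    rw [← Category.assoc, h.c_p, e]

theorem IsDisplaySystemOfMonics.preservesSpans_T (hM : 𝕋.IsDisplaySystemOfMonics M) :
    PreservesSpans 𝕋.T M :=
  hM.cartesianOn_p.preservesSpans hM.toPlain

theorem IsDisplaySystemOfMonics.preservesSpans_T2 (hM : 𝕋.IsDisplaySystemOfMonics M)
    (h : 𝕋.IsTangent) : PreservesSpans 𝕋.T2 M :=
  (hM.cartesianOn_π₁_p h).preservesSpans hM.toPlain

/-! ### The tangent structure on partial maps -/

/-- The tangent structure on the category of partial maps. -/
def par (h : 𝕋.IsTangent) (hM : 𝕋.IsDisplaySystemOfMonics M) : TangentData (Par hM.toPlain) where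
  T := Par.extend hM.toPlain hM.preservesSpans_T
  p :=
    { app := fun A => (Par.incl hM.toPlain).map (𝕋.p.app A.of)
      naturality := by
        rintro A B ⟨f⟩
        exact Par.naturality_of_cartesianOn hM.toPlain (G := 𝟭 C) hM.preservesSpans_T.map_mem
          (fun _ _ _ hm => hm) hM.cartesianOn_p f }
  T2 := Par.extend hM.toPlain (hM.preservesSpans_T2 h)
  π₁ :=
    { app := fun A => (Par.incl hM.toPlain).map (𝕋.π₁.app A.of)
      naturality := by
        rintro A B ⟨f⟩
        exact Par.naturality_of_cartesianOn hM.toPlain (hM.preservesSpans_T2 h).map_mem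
          hM.preservesSpans_T.map_mem (hM.cartesianOn_π₁ h) f }
  π₂ :=
    { app := fun A => (Par.incl hM.toPlain).map (𝕋.π₂.app A.of)
      naturality := by
        rintro A B ⟨f⟩
        exact Par.naturality_of_cartesianOn hM.toPlain (hM.preservesSpans_T2 h).map_mem
          hM.preservesSpans_T.map_mem (hM.cartesianOn_π₂ h) f }
  z :=
    { app := fun A => (Par.incl hM.toPlain).map (𝕋.z.app A.of)
      naturality := by
        rintro A B ⟨f⟩
        exact Par.naturality_of_cartesianOn hM.toPlain (F := 𝟭 C) (fun _ _ _ hm => hm)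
          hM.preservesSpans_T.map_mem (hM.cartesianOn_z h) f }
  s :=
    { app := fun A => (Par.incl hM.toPlain).map (𝕋.s.app A.of)
      naturality := by
        rintro A B ⟨f⟩
        exact Par.naturality_of_cartesianOn hM.toPlain (hM.preservesSpans_T2 h).map_mem
          hM.preservesSpans_T.map_mem (hM.cartesianOn_s h) f }
  l :=
    { app := fun A => (Par.incl hM.toPlain).map (𝕋.l.app A.of)
      naturality := by
        rintro A B ⟨f⟩
        exact Par.naturality_of_cartesianOn hM.toPlain (G := 𝕋.T ⋙ 𝕋.T)
          hM.preservesSpans_T.map_mem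
          (fun _ _ m hm => hM.system.map _ (hM.system.map m hm)) (hM.cartesianOn_l h) f }
  c :=
    { app := fun A => (Par.incl hM.toPlain).map (𝕋.c.app A.of)
      naturality := by
        rintro A B ⟨f⟩
        exact Par.naturality_of_cartesianOn hM.toPlain (F := 𝕋.T ⋙ 𝕋.T) (G := 𝕋.T ⋙ 𝕋.T)
          (fun _ _ m hm => hM.system.map _ (hM.system.map m hm))
          (fun _ _ m hm => hM.system.map _ (hM.system.map m hm)) (hM.cartesianOn_c h) f }

theorem par_T_map_incl (h : 𝕋.IsTangent) (hM : 𝕋.IsDisplaySystemOfMonics M)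
    {A B : C} (f : A ⟶ B) :
    (par h hM).T.map ((Par.incl hM.toPlain).map f) = (Par.incl hM.toPlain).map (𝕋.T.map f) :=
  Par.extend_map_incl hM.toPlain hM.preservesSpans_T f

/-- Here and in the next lemmas a conditional axiom is checked on generalized elements that are
partial. Their domains agree because their total composites do, so the axiom in `C` applies to the
right legs. -/
theorem par_s_unit (h : 𝕋.Equations) (hM : 𝕋.IsDisplaySystemOfMonics M) {A X : C}
    (u : (Par.incl hM.toPlain).obj X ⟶ (Par.incl hM.toPlain).obj (𝕋.T2.obj A))
    (w : u ≫ (Par.incl hM.toPlain).map (𝕋.π₂.app A) =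
      u ≫ (Par.incl hM.toPlain).map (𝕋.π₁.app A ≫ 𝕋.p.app A ≫ 𝕋.z.app A)) :
    u ≫ (Par.incl hM.toPlain).map (𝕋.s.app A) =
      u ≫ (Par.incl hM.toPlain).map (𝕋.π₁.app A) := by
  obtain ⟨D, m, hm, u, rfl⟩ := Par.exists_eq_ofSpan hM.toPlain u
  simp only [Par.ofSpan_comp_incl] at w ⊢
  rw [h.s_unit u (Par.ofSpan_injective hM.toPlain w)]

theorem par_s_comm (h : 𝕋.Equations) (hM : 𝕋.IsDisplaySystemOfMonics M) {A X : C}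
    (u v : (Par.incl hM.toPlain).obj X ⟶ (Par.incl hM.toPlain).obj (𝕋.T2.obj A))
    (w₁ : v ≫ (Par.incl hM.toPlain).map (𝕋.π₁.app A) =
      u ≫ (Par.incl hM.toPlain).map (𝕋.π₂.app A))
    (w₂ : v ≫ (Par.incl hM.toPlain).map (𝕋.π₂.app A) =
      u ≫ (Par.incl hM.toPlain).map (𝕋.π₁.app A)) :
    v ≫ (Par.incl hM.toPlain).map (𝕋.s.app A) =
      u ≫ (Par.incl hM.toPlain).map (𝕋.s.app A) := by
  obtain ⟨D, m, hm, u, rfl⟩ := Par.exists_eq_ofSpan hM.toPlain u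
  simp only [Par.ofSpan_comp_incl] at w₁ w₂ ⊢
  obtain ⟨v, rfl⟩ := Par.exists_of_comp_incl_eq hM.toPlain w₁
  simp only [Par.ofSpan_comp_incl] at w₁ w₂ ⊢
  rw [h.s_comm u v (Par.ofSpan_injective hM.toPlain w₁) (Par.ofSpan_injective hM.toPlain w₂)]

theorem par_s_assoc (h : 𝕋.Equations) (hM : 𝕋.IsDisplaySystemOfMonics M) {A X : C}
    (u v u' v' : (Par.incl hM.toPlain).obj X ⟶ (Par.incl hM.toPlain).obj (𝕋.T2.obj A))
    (w₁ : v ≫ (Par.incl hM.toPlain).map (𝕋.π₁.app A) =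
      u ≫ (Par.incl hM.toPlain).map (𝕋.π₂.app A))
    (w₂ : u' ≫ (Par.incl hM.toPlain).map (𝕋.π₁.app A) =
      u ≫ (Par.incl hM.toPlain).map (𝕋.s.app A))
    (w₃ : u' ≫ (Par.incl hM.toPlain).map (𝕋.π₂.app A) =
      v ≫ (Par.incl hM.toPlain).map (𝕋.π₂.app A))
    (w₄ : v' ≫ (Par.incl hM.toPlain).map (𝕋.π₁.app A) =
      u ≫ (Par.incl hM.toPlain).map (𝕋.π₁.app A))
    (w₅ : v' ≫ (Par.incl hM.toPlain).map (𝕋.π₂.app A) =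
      v ≫ (Par.incl hM.toPlain).map (𝕋.s.app A)) :
    u' ≫ (Par.incl hM.toPlain).map (𝕋.s.app A) =
      v' ≫ (Par.incl hM.toPlain).map (𝕋.s.app A) := by
  obtain ⟨D, m, hm, u, rfl⟩ := Par.exists_eq_ofSpan hM.toPlain u
  simp only [Par.ofSpan_comp_incl] at w₁ w₂ w₄
  -- Each of `v`, `u'` and `v'` has a hypothesis comparing it directly with `u`, so all four live on
  -- the domain `m`.
  obtain ⟨v, rfl⟩ := Par.exists_of_comp_incl_eq hM.toPlain w₁
  obtain ⟨u', rfl⟩ := Par.exists_of_comp_incl_eq hM.toPlain w₂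
  obtain ⟨v', rfl⟩ := Par.exists_of_comp_incl_eq hM.toPlain w₄
  simp only [Par.ofSpan_comp_incl] at w₁ w₂ w₃ w₄ w₅ ⊢
  rw [h.s_assoc u v u' v' (Par.ofSpan_injective hM.toPlain w₁)
    (Par.ofSpan_injective hM.toPlain w₂) (Par.ofSpan_injective hM.toPlain w₃)
    (Par.ofSpan_injective hM.toPlain w₄) (Par.ofSpan_injective hM.toPlain w₅)]

theorem par_s_l (h : 𝕋.Equations) (hM : 𝕋.IsDisplaySystemOfMonics M) {A X : C}
    (u : (Par.incl hM.toPlain).obj X ⟶ (Par.incl hM.toPlain).obj (𝕋.T2.obj A))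
    (w : (Par.incl hM.toPlain).obj X ⟶ (Par.incl hM.toPlain).obj (𝕋.T.obj (𝕋.T2.obj A)))
    (w₁ : w ≫ (Par.incl hM.toPlain).map (𝕋.T.map (𝕋.π₁.app A)) =
      u ≫ (Par.incl hM.toPlain).map (𝕋.π₁.app A ≫ 𝕋.l.app A))
    (w₂ : w ≫ (Par.incl hM.toPlain).map (𝕋.T.map (𝕋.π₂.app A)) =
      u ≫ (Par.incl hM.toPlain).map (𝕋.π₂.app A ≫ 𝕋.l.app A)) :
    w ≫ (Par.incl hM.toPlain).map (𝕋.T.map (𝕋.s.app A)) =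
      u ≫ (Par.incl hM.toPlain).map (𝕋.s.app A ≫ 𝕋.l.app A) := by
  obtain ⟨D, m, hm, u, rfl⟩ := Par.exists_eq_ofSpan hM.toPlain u
  simp only [Par.ofSpan_comp_incl] at w₁ w₂ ⊢
  obtain ⟨w, rfl⟩ := Par.exists_of_comp_incl_eq hM.toPlain w₁
  simp only [Par.ofSpan_comp_incl] at w₁ w₂ ⊢
  rw [h.s_l u w (Par.ofSpan_injective hM.toPlain w₁) (Par.ofSpan_injective hM.toPlain w₂)]

theorem par_s_c (h : 𝕋.Equations) (hM : 𝕋.IsDisplaySystemOfMonics M) {A X : C}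
    (w : (Par.incl hM.toPlain).obj X ⟶ (Par.incl hM.toPlain).obj (𝕋.T.obj (𝕋.T2.obj A)))
    (u : (Par.incl hM.toPlain).obj X ⟶ (Par.incl hM.toPlain).obj (𝕋.T2.obj (𝕋.T.obj A)))
    (w₁ : u ≫ (Par.incl hM.toPlain).map (𝕋.π₁.app (𝕋.T.obj A)) =
      w ≫ (Par.incl hM.toPlain).map (𝕋.T.map (𝕋.π₁.app A) ≫ 𝕋.c.app A))
    (w₂ : u ≫ (Par.incl hM.toPlain).map (𝕋.π₂.app (𝕋.T.obj A)) =
      w ≫ (Par.incl hM.toPlain).map (𝕋.T.map (𝕋.π₂.app A) ≫ 𝕋.c.app A)) :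
    u ≫ (Par.incl hM.toPlain).map (𝕋.s.app (𝕋.T.obj A)) =
      w ≫ (Par.incl hM.toPlain).map (𝕋.T.map (𝕋.s.app A) ≫ 𝕋.c.app A) := by
  obtain ⟨D, m, hm, w, rfl⟩ := Par.exists_eq_ofSpan hM.toPlain w
  simp only [Par.ofSpan_comp_incl] at w₁ w₂ ⊢
  obtain ⟨u, rfl⟩ := Par.exists_of_comp_incl_eq hM.toPlain w₁
  simp only [Par.ofSpan_comp_incl] at w₁ w₂ ⊢
  rw [h.s_c w u (Par.ofSpan_injective hM.toPlain w₁) (Par.ofSpan_injective hM.toPlain w₂)]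

/-- Partial maps satisfy the equational axioms of a tangent structure. -/
theorem par_equations (h : 𝕋.IsTangent) (hM : 𝕋.IsDisplaySystemOfMonics M) :
    (par h hM).Equations where
  z_p A := ((Par.incl hM.toPlain).map_comp _ _).symm.trans
    (congrArg (Par.incl hM.toPlain).map (h.z_p A.of))
  s_p A := ((Par.incl hM.toPlain).map_comp _ _).symm.trans
    ((congrArg (Par.incl hM.toPlain).map (h.s_p A.of)).trans ((Par.incl hM.toPlain).map_comp _ _))
  s_unit A X u w := by
    refine par_s_unit (A := A.of) (X := X.of) h.toEquations hM u ?_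
    simp only [Functor.map_comp]
    exact w
  s_comm A X u v w₁ w₂ := par_s_comm (A := A.of) (X := X.of) h.toEquations hM u v w₁ w₂
  s_assoc A X u v u' v' w₁ w₂ w₃ w₄ w₅ :=
    par_s_assoc (A := A.of) (X := X.of) h.toEquations hM u v u' v' w₁ w₂ w₃ w₄ w₅
  l_p A := by
    change (Par.incl hM.toPlain).map (𝕋.l.app A.of) ≫
        (par h hM).T.map ((Par.incl hM.toPlain).map (𝕋.p.app A.of)) =
      (Par.incl hM.toPlain).map (𝕋.p.app A.of) ≫ (Par.incl hM.toPlain).map (𝕋.z.app A.of)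
    rw [← Functor.map_comp, ← h.l_p, Functor.map_comp]
    exact congrArg (_ ≫ ·) (par_T_map_incl h hM _)
  z_l A := by
    change (Par.incl hM.toPlain).map (𝕋.z.app A.of) ≫ (Par.incl hM.toPlain).map (𝕋.l.app A.of) =
      (Par.incl hM.toPlain).map (𝕋.z.app A.of) ≫
        (par h hM).T.map ((Par.incl hM.toPlain).map (𝕋.z.app A.of))
    rw [← Functor.map_comp, h.z_l, Functor.map_comp]
    exact congrArg (_ ≫ ·) (par_T_map_incl h hM _).symm
  s_l A X u w w₁ w₂ := by
    refine (congrArg (w ≫ ·) (par_T_map_incl h hM (𝕋.s.app A.of))).trans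
      ((par_s_l (A := A.of) (X := X.of) h.toEquations hM u w ?_ ?_).trans
        (congrArg (u ≫ ·) ((Par.incl hM.toPlain).map_comp _ _)))
    · refine (congrArg (w ≫ ·) (par_T_map_incl h hM (𝕋.π₁.app A.of))).symm.trans (w₁.trans ?_)
      exact (congrArg (u ≫ ·) ((Par.incl hM.toPlain).map_comp _ _)).symm
    · refine (congrArg (w ≫ ·) (par_T_map_incl h hM (𝕋.π₂.app A.of))).symm.trans (w₂.trans ?_)
      exact (congrArg (u ≫ ·) ((Par.incl hM.toPlain).map_comp _ _)).symm
  c_p A := ((Par.incl hM.toPlain).map_comp _ _).symm.trans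
    ((congrArg (Par.incl hM.toPlain).map (h.c_p A.of)).trans (par_T_map_incl h hM _).symm)
  z_c A := (congrArg (· ≫ _) (par_T_map_incl h hM (𝕋.z.app A.of))).trans
    (((Par.incl hM.toPlain).map_comp _ _).symm.trans
      (congrArg (Par.incl hM.toPlain).map (h.z_c A.of)))
  s_c A X w u w₁ w₂ := by
    have key : ∀ {B : C} (f : B ⟶ 𝕋.T.obj A.of),
        (Par.incl hM.toPlain).map (𝕋.T.map f ≫ 𝕋.c.app A.of) =
          (par h hM).T.map ((Par.incl hM.toPlain).map f) ≫ (par h hM).c.app A := fun f =>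
      ((Par.incl hM.toPlain).map_comp _ _).trans (congrArg (· ≫ _) (par_T_map_incl h hM f).symm)
    exact (par_s_c (A := A.of) (X := X.of) h.toEquations hM w u
      (w₁.trans (congrArg (w ≫ ·) (key (𝕋.π₁.app A.of)).symm))
      (w₂.trans (congrArg (w ≫ ·) (key (𝕋.π₂.app A.of)).symm))).trans
      (congrArg (w ≫ ·) (key (𝕋.s.app A.of)))
  c_c A := ((Par.incl hM.toPlain).map_comp _ _).symm.trans
    (congrArg (Par.incl hM.toPlain).map (h.c_c A.of))
  l_c A := ((Par.incl hM.toPlain).map_comp _ _).symm.trans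
    (congrArg (Par.incl hM.toPlain).map (h.l_c A.of))
  l_l A := (congrArg (_ ≫ ·) (par_T_map_incl h hM (𝕋.l.app A.of))).trans
    (((Par.incl hM.toPlain).map_comp _ _).symm.trans
      ((congrArg (Par.incl hM.toPlain).map (h.l_l A.of)).trans
        ((Par.incl hM.toPlain).map_comp _ _)))
  c_c_c A := by
    have e := congrArg (Par.incl hM.toPlain).map (h.c_c_c A.of)
    simp only [Functor.map_comp] at e
    have t := par_T_map_incl h hM (𝕋.c.app A.of)
    exact (congrArg₂ (fun x y => x ≫ _ ≫ y) t t).trans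
      (e.trans (congrArg (fun x => _ ≫ x ≫ _) t).symm)
  l_c_c A := by
    have e := congrArg (Par.incl hM.toPlain).map (h.l_c_c A.of)
    simp only [Functor.map_comp] at e
    exact (congrArg (fun x => _ ≫ x ≫ _) (par_T_map_incl h hM (𝕋.c.app A.of))).trans
      (e.trans (congrArg (_ ≫ ·) (par_T_map_incl h hM (𝕋.l.app A.of)).symm))

/-- Partial maps form a restriction tangent category. -/
theorem isRestrictionTangent_par (h : 𝕋.IsTangent) (hM : 𝕋.IsDisplaySystemOfMonics M) :
    (par h hM).IsRestrictionTangent where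
  toIsRestrictionCategory := Par.isRestrictionCategory hM.toPlain
  toEquations := par_equations h hM
  map_rst := by
    rintro A B ⟨f⟩
    rfl
  total_p A := Par.isTotal_incl hM.toPlain _
  total_z A := Par.isTotal_incl hM.toPlain _
  total_s A := Par.isTotal_incl hM.toPlain _
  total_l A := Par.isTotal_incl hM.toPlain _
  total_c A := Par.isTotal_incl hM.toPlain _
  powers n A := by
    obtain ⟨P, base, π, hP⟩ := h.powers n A.of
    exact ⟨(Par.incl hM.toPlain).obj P, (Par.incl hM.toPlain).map base,
      fun i => (Par.incl hM.toPlain).map (π i),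
      fun m => Par.isRestrictionPullbackPower_iter_incl hM.toPlain hM.preservesSpans_T m (hP m)⟩
  T2_pullback A :=
    Par.isRestrictionTPullback_incl hM.toPlain hM.preservesSpans_T (h.T2_pullback A.of)
  universal A := by
    obtain ⟨w, w₁, w₂, hw⟩ := h.universal A.of
    have e₁ := congrArg (Par.incl hM.toPlain).map w₁
    have e₂ := congrArg (Par.incl hM.toPlain).map w₂
    have key := Par.isRestrictionTPullback_incl hM.toPlain hM.preservesSpans_T hw
    simp only [Functor.map_comp, ← par_T_map_incl h hM] at e₁ e₂
    rw [Functor.map_comp, Functor.map_comp, ← par_T_map_incl h hM, ← par_T_map_incl h hM] at key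
    exact ⟨(Par.incl hM.toPlain).map w, e₁, e₂, key⟩

theorem isStrictTangentFunctor_incl (h : 𝕋.IsTangent) (hM : 𝕋.IsDisplaySystemOfMonics M) :
    IsStrictTangentFunctor (Par.incl hM.toPlain) 𝕋 (par h hM) where
  T_comm := (Par.incl_comp_extend hM.toPlain hM.preservesSpans_T).symm
  T2_comm := (Par.incl_comp_extend hM.toPlain (hM.preservesSpans_T2 h)).symm
  -- The object equalities hold definitionally, so every `eqToHom` here reduces to an identity.
  map_p _ := (Category.id_comp _).symm
  map_z _ := Category.comp_id _
  map_π₁ _ := (Category.comp_id _).trans (Category.id_comp _).symm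
  map_π₂ _ := (Category.comp_id _).trans (Category.id_comp _).symm
  map_s _ := (Category.comp_id _).trans (Category.id_comp _).symm
  map_l _ := (Category.comp_id _).trans (Category.id_comp _).symm
  map_c _ := (Category.comp_id _).trans (Category.id_comp _).symm

end TangentData

end TangentCat

theorem mainTheorem5 {C : Type u} [Category.{v} C] (𝕋 : TangentCat.TangentData C)
    (h𝕋 : 𝕋.IsTangent) :
    -- the open subobjects form the maximal tangent display system of monics
    ∃ hO : 𝕋.IsDisplaySystemOfMonics 𝕋.opens,
      (∀ M : MorphismProperty C, 𝕋.IsDisplaySystemOfMonics M → M ≤ 𝕋.opens) ∧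
      -- partial maps with open domains form a split restriction category, which contains `C`
      -- as the category of all objects and total maps
      TangentCat.IsSplitRestrictionCategory (TangentCat.Par hO.toPlain) ∧
      Function.Injective (TangentCat.Par.incl hO.toPlain).obj ∧
      (TangentCat.Par.incl hO.toPlain).Faithful ∧
      (∀ (A B : C) (g : (TangentCat.Par.incl hO.toPlain).obj A ⟶
          (TangentCat.Par.incl hO.toPlain).obj B),
        TangentCat.IsTotal g ↔ ∃ f : A ⟶ B, (TangentCat.Par.incl hO.toPlain).map f = g) ∧
      -- it is a restriction tangent category, the inclusion strictly preserves all the tangent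
      -- structure, and the tangent bundle functor sends the span `[m, f]` to `[T m, T f]`
      ∃ 𝕋' : TangentCat.TangentData (TangentCat.Par hO.toPlain),
        𝕋'.IsRestrictionTangent ∧
        ∃ hJ : TangentCat.IsStrictTangentFunctor (TangentCat.Par.incl hO.toPlain) 𝕋 𝕋',
          ∀ (A B : C) (f : TangentCat.MSpan 𝕋.opens A B),
            𝕋'.T.map (TangentCat.Par.homMk hO.toPlain f) =
              eqToHom (hJ.obj_T A).symm ≫
                TangentCat.Par.homMk hO.toPlain (f.mapT hO.system) ≫
                eqToHom (hJ.obj_T B) := by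
  have hO := TangentCat.TangentData.isDisplaySystemOfMonics_opens h𝕋.toEquations
  refine ⟨hO, fun M hM => hM.le_opens, TangentCat.Par.isSplitRestrictionCategory hO.toPlain,
    fun A B hAB => congrArg TangentCat.Par.of hAB,
    ⟨fun hfg => TangentCat.Par.incl_map_injective hO.toPlain hfg⟩,
    fun A B g => TangentCat.Par.isTotal_iff hO.toPlain g,
    TangentCat.TangentData.par h𝕋 hO, TangentCat.TangentData.isRestrictionTangent_par h𝕋 hO,
    TangentCat.TangentData.isStrictTangentFunctor_incl h𝕋 hO, fun A B f => ?_⟩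
  exact ((Category.id_comp _).trans (Category.comp_id _)).symm
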